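/- Let $X=[\underline x,\overline x]$ and $Y=[\underline y,\overline y]$ with $\underline x<\overline x$ and $\underline y<\overline y$, and let $\mu\in\Delta(X)$ (distribution of firms) and $\nu\in\Delta(Y)$ (distribution of workers) have continuous, strictly positive densities. Here $\Delta(\cdot)$ denotes the set of Borel probability measures with the topology of weak convergence. Let $v:X\times\mathbb R\to\mathbb R$ and $m:X\times Y\to\mathbb R$ be twice continuously differentiable with $v_z>0$, $m_y>0$ and $v_{zz}<0<v_{xz}$ everywhere, and let $$V(x,\eta)=v\big(x,\mathbb E_\eta[m(x,y)]\big),\qquad (x,\eta)\in X\times\Delta(Y).$$ An assignment is a $\gamma\in\Delta(X\times\Delta(Y))$ whose marginal on $X$ is $\mu$ and whose average workforce satisfies $\mathbb E_\gamma[\eta]=\nu$. It is an equilibrium assignment if there are Lipschitz functions $p:X\to\mathbb R$ and $q:Y\to\mathbb R$ with $p(x)+\mathbb E_\eta[q(y)]\ge V(x,\eta)$ for all $(x,\eta)\in X\times\Delta(Y)$, and with equality for all $(x,\eta)\in\operatorname{supp}(\gamma)$. An assignment $\gamma$ is strictly single-dipped (resp. strictly single-peaked) if there are a Borel set $X^*\subset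 X$ with $\mu(X^*)=1$ and functions $\rho:X^*\to[0,1]$ and $T_d,T_u:X^*\to Y$ with $T_d\le T_u$ such that 1. $\eta=(1-\rho(x))\delta_{T_d(x)}+\rho(x)\delta_{T_u(x)}$ for all $(x,\eta)\in\operatorname{supp}(\gamma)$ with $x\in X^*$; and 2. $T_d(x'),T_u(x')\notin(T_d(x),T_u(x))$ for all $x,x'\in X^*$ with $x<x'$ (resp. with $x'<x$). **Theorem.** If $m_y$ is strictly log-supermodular (resp. strictly log-submodular), meaning that for every $x\in X$ the function $y\mapsto m_{xy}(x,y)/m_y(x,y)$ is strictly increasing (resp. strictly decreasing) on $Y$, then there is exactly one equilibrium assignment, and it is strictly single-dipped (resp. strictly single-peaked). In particular, $\mu$-almost every firm hires a mixture of at most two worker types. -/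

import Mathlib

open MeasureTheory Set

namespace ManyToOne

section Model

variable {X Y : Type*} [MetricSpace X] [CompactSpace X] [MeasurableSpace X] [BorelSpace X]
  [MetricSpace Y] [CompactSpace Y] [MeasurableSpace Y] [BorelSpace Y]

/-- A distribution `γ` over (firm, workforce) pairs is an assignment for the firm distribution `μ`
and the worker distribution `ν` if its marginal over firms is `μ` and its average workforce
is `ν`.  The space of workforces `ProbabilityMeasure Y` carries the topology of weak convergence,
which is the one metrized by the Kantorovich-Rubinstein distance. -/
structure IsAssignment (μ : ProbabilityMeasure X) (ν : ProbabilityMeasure Y)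
    (γ : ProbabilityMeasure (X × ProbabilityMeasure Y)) : Prop where
  firm_marginal : (γ : Measure (X × ProbabilityMeasure Y)).map Prod.fst = (μ : Measure X)
  mean_workforce : ∀ A : Set Y, MeasurableSet A →
    ∫⁻ w, (w.2 : Measure Y) A ∂(γ : Measure (X × ProbabilityMeasure Y)) = (ν : Measure Y) A

/-- An assignment `γ` together with Lipschitz prices `(p, q)` is a competitive equilibrium. -/
structure IsCompetitiveEquilibrium (V : X → ProbabilityMeasure Y → ℝ)
    (μ : ProbabilityMeasure X) (ν : ProbabilityMeasure Y)
    (γ : ProbabilityMeasure (X × ProbabilityMeasure Y)) (p : X → ℝ) (q : Y → ℝ) : Prop where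
  assignment : IsAssignment μ ν γ
  lipschitz_p : ∃ K, LipschitzWith K p
  lipschitz_q : ∃ K, LipschitzWith K q
  profit_eq : ∀ w ∈ (γ : Measure (X × ProbabilityMeasure Y)).support,
    p w.1 + ∫ y, q y ∂(w.2 : Measure Y) = V w.1 w.2
  profit_ge : ∀ (x : X) (η : ProbabilityMeasure Y),
    V x η ≤ p x + ∫ y, q y ∂(η : Measure Y)

/-- `γ` is an equilibrium assignment: it is part of some competitive equilibrium. -/
def IsEquilibriumAssignment (V : X → ProbabilityMeasure Y → ℝ)
    (μ : ProbabilityMeasure X) (ν : ProbabilityMeasure Y)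
    (γ : ProbabilityMeasure (X × ProbabilityMeasure Y)) : Prop :=
  ∃ (p : X → ℝ) (q : Y → ℝ), IsCompetitiveEquilibrium V μ ν γ p q

end Model

section OneDimensional

variable {a b c d : ℝ}

/-- The measure `μ` on `[a, b]` has a continuous and strictly positive density with respect to
Lebesgue measure. -/
def HasContPosDensity (μ : ProbabilityMeasure (Icc a b)) : Prop :=
  ∃ f : Icc a b → ℝ, Continuous f ∧ (∀ x, 0 < f x) ∧
    (μ : Measure (Icc a b)) = (Measure.comap Subtype.val (volume : Measure ℝ)).withDensity
      (fun x => ENNReal.ofReal (f x))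

/-- On the firms in `Xs`, every workforce in the support of `γ` is the mixture
`(1 - ρ x) δ_{Td x} + ρ x δ_{Tu x}`. -/
structure IsTwoPointOn (γ : ProbabilityMeasure (Icc a b × ProbabilityMeasure (Icc c d)))
    (Xs : Set (Icc a b)) (ρ : Icc a b → ℝ) (Td Tu : Icc a b → Icc c d) : Prop where
  rho_mem : ∀ x ∈ Xs, ρ x ∈ Icc (0 : ℝ) 1
  le : ∀ x ∈ Xs, Td x ≤ Tu x
  eq_mixture : ∀ w ∈ (γ : Measure (Icc a b × ProbabilityMeasure (Icc c d))).support, w.1 ∈ Xs →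
    (w.2 : Measure (Icc c d)) =
      ENNReal.ofReal (1 - ρ w.1) • Measure.dirac (Td w.1)
        + ENNReal.ofReal (ρ w.1) • Measure.dirac (Tu w.1)

/-- Workers employed by a more productive firm never lie strictly between the two worker types of
a less productive firm. -/
def IsStrictlySingleDipped (μ : ProbabilityMeasure (Icc a b))
    (γ : ProbabilityMeasure (Icc a b × ProbabilityMeasure (Icc c d))) : Prop :=
  ∃ (Xs : Set (Icc a b)) (ρ : Icc a b → ℝ) (Td Tu : Icc a b → Icc c d),
    MeasurableSet Xs ∧ (μ : Measure (Icc a b)) Xs = 1 ∧ IsTwoPointOn γ Xs ρ Td Tu ∧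
    ∀ x ∈ Xs, ∀ x' ∈ Xs, x < x' → Td x' ∉ Ioo (Td x) (Tu x) ∧ Tu x' ∉ Ioo (Td x) (Tu x)

/-- Workers employed by a less productive firm never lie strictly between the two worker types of
a more productive firm. -/
def IsStrictlySinglePeaked (μ : ProbabilityMeasure (Icc a b))
    (γ : ProbabilityMeasure (Icc a b × ProbabilityMeasure (Icc c d))) : Prop :=
  ∃ (Xs : Set (Icc a b)) (ρ : Icc a b → ℝ) (Td Tu : Icc a b → Icc c d),
    MeasurableSet Xs ∧ (μ : Measure (Icc a b)) Xs = 1 ∧ IsTwoPointOn γ Xs ρ Td Tu ∧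
    ∀ x ∈ Xs, ∀ x' ∈ Xs, x' < x → Td x' ∉ Ioo (Td x) (Tu x) ∧ Tu x' ∉ Ioo (Td x) (Tu x)

/-- The value `V(x, η) = v(x, E_η[m(x, y)])`. -/
noncomputable def momentValue (v m : ℝ → ℝ → ℝ) (x : Icc a b)
    (η : ProbabilityMeasure (Icc c d)) : ℝ :=
  v x (∫ y : Icc c d, m x y ∂(η : Measure (Icc c d)))

end OneDimensional

/-- The partial derivative `m_y(x, y)` for `y ∈ [c, d]` (one-sided at the end points). -/
noncomputable def partialY (c d : ℝ) (m : ℝ → ℝ → ℝ) (x y : ℝ) : ℝ :=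
  derivWithin (fun t => m x t) (Icc c d) y

/-- The partial derivative `m_{xy}(x, y)` for `x ∈ [a, b]`, `y ∈ [c, d]` (one-sided at the
end points). -/
noncomputable def partialXY (a b c d : ℝ) (m : ℝ → ℝ → ℝ) (x y : ℝ) : ℝ :=
  derivWithin (fun s => partialY c d m s y) (Icc a b) x

/-- `m_y` is strictly log-supermodular: `m_{xy} / m_y` is strictly increasing in `y`. -/
def StrictlyLogSupermodular (a b c d : ℝ) (m : ℝ → ℝ → ℝ) : Prop :=
  ∀ x ∈ Icc a b, StrictMonoOn (fun y => partialXY a b c d m x y / partialY c d m x y) (Icc c d)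

/-- `m_y` is strictly log-submodular: `m_{xy} / m_y` is strictly decreasing in `y`. -/
def StrictlyLogSubmodular (a b c d : ℝ) (m : ℝ → ℝ → ℝ) : Prop :=
  ∀ x ∈ Icc a b, StrictAntiOn (fun y => partialXY a b c d m x y / partialY c d m x y) (Icc c d)

/-- The standing assumptions of the moment-measurable case on the output function `v` on
`[a, b] × ℝ` and the labor input function `m` on `[a, b] × [c, d]`: both are twice continuously
differentiable, `v_z > 0`, `m_y > 0`, and `v_{zz} < 0 < v_{xz}`. -/
structure IsMomentSpecification (a b c d : ℝ) (v m : ℝ → ℝ → ℝ) : Prop where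
  contDiff_v : ContDiffOn ℝ 2 (fun w : ℝ × ℝ => v w.1 w.2) (Icc a b ×ˢ univ)
  contDiff_m : ContDiffOn ℝ 2 (fun w : ℝ × ℝ => m w.1 w.2) (Icc a b ×ˢ Icc c d)
  v_z_pos : ∀ x ∈ Icc a b, ∀ z, 0 < deriv (v x) z
  m_y_pos : ∀ x ∈ Icc a b, ∀ y ∈ Icc c d, 0 < partialY c d m x y
  v_zz_neg : ∀ x ∈ Icc a b, ∀ z, deriv (deriv (v x)) z < 0
  v_xz_pos : ∀ x ∈ Icc a b, ∀ z, 0 < derivWithin (fun s => deriv (v s) z) (Icc a b) x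

end ManyToOne

namespace ManyToOne

/-! ### Weak topology and Borel structure on the space of workforces. -/

section WorkforceSpace

set_option linter.unusedSectionVars false

open Topology

variable {Y : Type*} [MetricSpace Y] [CompactSpace Y] [MeasurableSpace Y] [BorelSpace Y]

/-! Equilibrium wages are minimizers of the dual objective, total maximal profits plus total wages.
Any wages can be lowered to uniformly Lipschitz ones without raising profits
(`exists_lipschitz_improvement`), and additive constants do not matter, so Arzelà-Ascoli gives a
minimizer `q`.

Fix such a `q`. Strict concavity of `v x` pins down the moment `z x` that firm `x` buys, and the
first-order condition reads `φ m(x, y) - q y ≤ w x` with `φ = v_z(x, z x)`. Equality holds on a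
contact set `Γ x` that carries every optimal workforce. If `m_y(x', ·) / m_y(x, ·)` is strictly
increasing, then `φ' m(x', ·) - φ m(x, ·)` has no interior peak (`IsMomentSpecification.crossing`),
so no point of `Γ x'` lies strictly between two points of `Γ x`. Hence only countably many contact
sets contain three points (`countable_three_point`), and these firms are `μ`-null. For the others `Γ
x` has at most two points and `z x` fixes the weights, so the optimal workforce is unique.

Almost sure uniqueness makes the dual objective differentiable at `q`. Stationarity says that the
labor market clears, so the optimal workforces form an equilibrium. Conversely, by complementary
slackness every equilibrium assignment lives on the graph of optimal workforces at `q`, which is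
almost surely single-valued (`exists_unique_equilibriumAssignment`). -/

theorem integrable_of_continuous {Z : Type*} [TopologicalSpace Z] [CompactSpace Z]
    [SecondCountableTopology Z] [MeasurableSpace Z] [OpensMeasurableSpace Z] {f : Z → ℝ}
    (hf : Continuous f) (η : Measure Z) [IsFiniteMeasure η] : Integrable f η :=
  hf.integrable_of_hasCompactSupport (HasCompactSupport.of_compactSpace _)

instance secondCountableTopology_probabilityMeasure :
    SecondCountableTopology (ProbabilityMeasure Y) := by
  let := TopologicalSpace.metrizableSpaceMetric (ProbabilityMeasure Y)
  infer_instance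

/-- Indicators of closed sets are limits of continuous functions, and closed sets form a generating
π-system. The general source `α` lets this apply to the Borel σ-algebra on workforces before it is
identified with the one generated by evaluations. -/
theorem measurable_toMeasure_of_continuous {α : Type*} [TopologicalSpace α] [MeasurableSpace α]
    [OpensMeasurableSpace α] {e : α → ProbabilityMeasure Y} (he : Continuous e) :
    Measurable fun a => (e a : Measure Y) := by
  refine Measurable.measure_of_isPiSystem_of_isProbabilityMeasure
    (BorelSpace.measurable_eq.trans borel_eq_generateFrom_isClosed) isPiSystem_isClosed ?_
  intro F (hF : IsClosed F)
  have h : ∀ n : ℕ, Measurable fun a => ∫⁻ y, hF.apprSeq n y ∂(e a : Measure Y) := fun n =>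
    ((ProbabilityMeasure.continuous_lintegral_boundedContinuousFunction _).comp he).measurable
  exact measurable_of_tendsto_metrizable h
    (tendsto_pi_nhds.2 fun a => HasOuterApproxClosed.tendsto_lintegral_apprSeq hF _)

theorem measurable_toMeasure :
    Measurable fun η : ProbabilityMeasure Y => (η : Measure Y) := measurable_subtype_coe

theorem measurable_integral_continuousMap (f : C(Y, ℝ)) :
    Measurable fun η : ProbabilityMeasure Y => ∫ y, f y ∂(η : Measure Y) := by
  let κ : ProbabilityTheory.Kernel (ProbabilityMeasure Y) Y :=
    ⟨fun η => (η : Measure Y), measurable_toMeasure⟩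
  exact (StronglyMeasurable.integral_kernel (κ := κ)
    f.continuous.measurable.stronglyMeasurable).measurable

theorem abs_integral_sub_le (f g : C(Y, ℝ)) (η : ProbabilityMeasure Y) :
    |∫ y, f y ∂(η : Measure Y) - ∫ y, g y ∂(η : Measure Y)| ≤ ‖f - g‖ := by
  have hf : Integrable (fun y => f y) (η : Measure Y) := integrable_of_continuous f.continuous _
  have hg : Integrable (fun y => g y) (η : Measure Y) := integrable_of_continuous g.continuous _
  rw [← integral_sub hf hg]
  have := norm_integral_le_of_norm_le_const (μ := (η : Measure Y)) (f := fun y => f y - g y)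
    (Filter.Eventually.of_forall fun y => (f - g).norm_coe_le_norm y)
  simpa using this

theorem continuous_integral_prod :
    Continuous fun w : C(Y, ℝ) × ProbabilityMeasure Y => ∫ y, w.1 y ∂(w.2 : Measure Y) := by
  rw [continuous_iff_continuousAt]
  rintro ⟨f, η⟩
  have h1 : Filter.Tendsto (fun w : C(Y, ℝ) × ProbabilityMeasure Y => ‖w.1 - f‖)
      (𝓝 (f, η)) (𝓝 0) := by
    have : Continuous fun w : C(Y, ℝ) × ProbabilityMeasure Y => ‖w.1 - f‖ := by fun_prop
    simpa using this.tendsto (f, η)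
  have h2 : Filter.Tendsto (fun w : C(Y, ℝ) × ProbabilityMeasure Y =>
      ∫ y, w.1 y ∂(w.2 : Measure Y) - ∫ y, f y ∂(w.2 : Measure Y)) (𝓝 (f, η)) (𝓝 0) :=
    squeeze_zero_norm (fun w => abs_integral_sub_le w.1 f w.2) h1
  have h3 : Filter.Tendsto (fun w : C(Y, ℝ) × ProbabilityMeasure Y =>
      ∫ y, f y ∂(w.2 : Measure Y)) (𝓝 (f, η)) (𝓝 (∫ y, f y ∂(η : Measure Y))) :=
    ((ProbabilityMeasure.continuous_integral_continuousMap f).comp continuous_snd).tendsto (f, η)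
  simpa [ContinuousAt] using h2.add h3

instance borelSpace_probabilityMeasure : BorelSpace (ProbabilityMeasure Y) := by
  constructor
  apply le_antisymm
  · let m₀ : MeasurableSpace (ProbabilityMeasure Y) := borel _
    have : @BorelSpace (ProbabilityMeasure Y) _ m₀ := ⟨rfl⟩
    have h := measurable_toMeasure_of_continuous (Y := Y) (α := ProbabilityMeasure Y) continuous_id
    exact measurable_iff_comap_le.1 h
  -- Integrals against a countable dense family embed the compact space of workforces into `ℕ → ℝ`,
  -- so the topology is induced by a map measurable for the evaluation σ-algebra.
  · let s := TopologicalSpace.denseSeq C(Y, ℝ)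
    let Φ : ProbabilityMeasure Y → ℕ → ℝ := fun η n => ∫ y, s n y ∂(η : Measure Y)
    have hΦc : Continuous Φ := continuous_pi fun n =>
      ProbabilityMeasure.continuous_integral_continuousMap (s n)
    have hΦm : Measurable Φ := measurable_pi_lambda _ fun n => measurable_integral_continuousMap _
    have hΦi : Function.Injective Φ := by
      intro η η' h
      have hd : ∀ f : C(Y, ℝ), ∫ y, f y ∂(η : Measure Y) = ∫ y, f y ∂(η' : Measure Y) := by
        intro f
        refine (TopologicalSpace.denseRange_denseSeq C(Y, ℝ)).induction_on f
          (isClosed_eq ?_ ?_) fun n => congrFun h n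
        · exact continuous_integral_prod.comp (continuous_id.prodMk continuous_const)
        · exact continuous_integral_prod.comp (continuous_id.prodMk continuous_const)
      apply ProbabilityMeasure.toMeasure_injective
      exact ext_of_forall_integral_eq_of_IsFiniteMeasure fun f => hd f.toContinuousMap
    have hΦe := (hΦc.isClosedEmbedding hΦi).isEmbedding.isInducing
    rw [hΦe.eq_induced, borel_comap, ← BorelSpace.measurable_eq]
    exact hΦm.comap_le

end WorkforceSpace

/-! ### The dual problem in wages and its minimizers. -/

section Duality

set_option linter.unusedSectionVars false

open Topology Filter

variable {X Y : Type*} [MetricSpace X] [CompactSpace X] [MeasurableSpace X] [BorelSpace X]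
  [MetricSpace Y] [CompactSpace Y] [MeasurableSpace Y] [BorelSpace Y]

/-- The profit of firm `x` from the workforce `η` at wages `q`. -/
noncomputable def profit (V : X → ProbabilityMeasure Y → ℝ) (q : C(Y, ℝ)) (x : X)
    (η : ProbabilityMeasure Y) : ℝ :=
  V x η - ∫ y, q y ∂(η : Measure Y)

/-- The profit-maximizing workforces of firm `x` at wages `q`. -/
def optimalWorkforces (V : X → ProbabilityMeasure Y → ℝ) (q : C(Y, ℝ)) (x : X) :
    Set (ProbabilityMeasure Y) :=
  {η | ∀ η', profit V q x η' ≤ profit V q x η}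

/-- The maximal profit of firm `x` at wages `q`. -/
noncomputable def maxProfit (V : X → ProbabilityMeasure Y → ℝ) (q : C(Y, ℝ)) (x : X) : ℝ :=
  ⨆ η, profit V q x η

/-- The dual objective: total profits plus total wages. -/
noncomputable def dualValue (V : X → ProbabilityMeasure Y → ℝ) (μ : ProbabilityMeasure X)
    (ν : ProbabilityMeasure Y) (q : C(Y, ℝ)) : ℝ :=
  ∫ x, maxProfit V q x ∂(μ : Measure X) + ∫ y, q y ∂(ν : Measure Y)

variable {V : X → ProbabilityMeasure Y → ℝ} {μ : ProbabilityMeasure X} {ν : ProbabilityMeasure Y}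

theorem continuous_profit (hV : Continuous fun w : X × ProbabilityMeasure Y => V w.1 w.2)
    (q : C(Y, ℝ)) : Continuous fun w : X × ProbabilityMeasure Y => profit V q w.1 w.2 :=
  hV.sub ((ProbabilityMeasure.continuous_integral_continuousMap q).comp continuous_snd)

theorem isClosed_graph_optimalWorkforces
    (hV : Continuous fun w : X × ProbabilityMeasure Y => V w.1 w.2) (q : C(Y, ℝ)) :
    IsClosed {w : X × ProbabilityMeasure Y | w.2 ∈ optimalWorkforces V q w.1} := by
  have : {w : X × ProbabilityMeasure Y | w.2 ∈ optimalWorkforces V q w.1}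
      = ⋂ η', {w | profit V q w.1 η' ≤ profit V q w.1 w.2} := by
    ext w
    simp [optimalWorkforces]
  rw [this]
  refine isClosed_iInter fun η' => isClosed_le ?_ (continuous_profit hV q)
  exact (continuous_profit hV q).comp (continuous_fst.prodMk continuous_const)

theorem nonempty_optimalWorkforces [Nonempty Y]
    (hV : Continuous fun w : X × ProbabilityMeasure Y => V w.1 w.2) (q : C(Y, ℝ)) (x : X) :
    (optimalWorkforces V q x).Nonempty := by
  have : Nonempty (ProbabilityMeasure Y) :=
    ⟨⟨Measure.dirac (Classical.arbitrary Y), inferInstance⟩⟩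
  obtain ⟨η, -, hη⟩ := isCompact_univ.exists_isMaxOn (univ_nonempty (α := ProbabilityMeasure Y))
    ((continuous_profit hV q).comp (Continuous.prodMk_right x)).continuousOn
  exact ⟨η, fun η' => hη (mem_univ η')⟩

theorem maxProfit_eq {q : C(Y, ℝ)} {x : X} {η : ProbabilityMeasure Y}
    (hη : η ∈ optimalWorkforces V q x) : maxProfit V q x = profit V q x η :=
  have : Nonempty (ProbabilityMeasure Y) := ⟨η⟩
  le_antisymm (ciSup_le hη) (le_ciSup ⟨_, by rintro _ ⟨η', rfl⟩; exact hη η'⟩ η)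

variable [Nonempty Y]

theorem profit_le_maxProfit (hV : Continuous fun w : X × ProbabilityMeasure Y => V w.1 w.2)
    (q : C(Y, ℝ)) (x : X) (η : ProbabilityMeasure Y) : profit V q x η ≤ maxProfit V q x := by
  obtain ⟨η', hη'⟩ := nonempty_optimalWorkforces hV q x
  rw [maxProfit_eq hη']
  exact hη' η

theorem maxProfit_le
    (hV : Continuous fun w : X × ProbabilityMeasure Y => V w.1 w.2) {q : C(Y, ℝ)} {x : X} {r : ℝ}
    (h : ∀ η, profit V q x η ≤ r) : maxProfit V q x ≤ r := by
  obtain ⟨η', hη'⟩ := nonempty_optimalWorkforces hV q x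
  rw [maxProfit_eq hη']
  exact h η'

theorem maxProfit_le_add_norm (hV : Continuous fun w : X × ProbabilityMeasure Y => V w.1 w.2)
    (q q' : C(Y, ℝ)) (x : X) : maxProfit V q x ≤ maxProfit V q' x + ‖q - q'‖ := by
  refine maxProfit_le hV fun η => ?_
  have h1 := profit_le_maxProfit hV q' x η
  have h2 := (abs_le.1 (abs_integral_sub_le q q' η)).1
  simp only [profit] at *
  linarith

theorem maxProfit_sub_const (hV : Continuous fun w : X × ProbabilityMeasure Y => V w.1 w.2)
    (q : C(Y, ℝ)) (r : ℝ) (x : X) :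
    maxProfit V (q - ContinuousMap.const Y r) x = maxProfit V q x + r := by
  obtain ⟨η, hη⟩ := nonempty_optimalWorkforces hV q x
  have key : ∀ η, profit V (q - ContinuousMap.const Y r) x η = profit V q x η + r := by
    intro η
    have : ∫ y, (q - ContinuousMap.const Y r) y ∂(η : Measure Y)
        = ∫ y, q y ∂(η : Measure Y) - r := by
      simp only [ContinuousMap.sub_apply, ContinuousMap.const_apply]
      rw [integral_sub (integrable_of_continuous q.continuous _) (integrable_const _)]
      simp
    rw [profit, this, profit]
    ring
  have hη' : η ∈ optimalWorkforces V (q - ContinuousMap.const Y r) x := by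
    intro η'
    rw [key, key]
    linarith [hη η']
  rw [maxProfit_eq hη', maxProfit_eq hη, key]

theorem lipschitzWith_maxProfit (hV : Continuous fun w : X × ProbabilityMeasure Y => V w.1 w.2)
    {L : NNReal} (hL : ∀ η, LipschitzWith L fun x => V x η) (q : C(Y, ℝ)) :
    LipschitzWith L (maxProfit V q) := by
  refine LipschitzWith.of_le_add_mul L fun x x' => ?_
  refine maxProfit_le hV fun η => ?_
  have h1 := profit_le_maxProfit hV q x' η
  have h2 := (hL η).le_add_mul x x'
  simp only [profit] at *
  linarith

/-- Firms and workers both have mass one, so a uniform wage cut is a pure transfer. This permits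
normalizing the wage at one type. -/
theorem dualValue_sub_const (hV : Continuous fun w : X × ProbabilityMeasure Y => V w.1 w.2)
    {L : NNReal} (hL : ∀ η, LipschitzWith L fun x => V x η) (q : C(Y, ℝ)) (r : ℝ) :
    dualValue V μ ν (q - ContinuousMap.const Y r) = dualValue V μ ν q := by
  have h1 := (lipschitzWith_maxProfit hV hL q).continuous
  simp only [dualValue, maxProfit_sub_const hV, ContinuousMap.sub_apply,
    ContinuousMap.const_apply]
  rw [integral_add (integrable_of_continuous h1 _) (integrable_const _),
    integral_sub (integrable_of_continuous q.continuous _) (integrable_const _)]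
  simp

theorem continuous_dualValue (hV : Continuous fun w : X × ProbabilityMeasure Y => V w.1 w.2)
    {L : NNReal} (hL : ∀ η, LipschitzWith L fun x => V x η) :
    Continuous (dualValue V μ ν) := by
  refine LipschitzWith.continuous (K := 2) (LipschitzWith.of_le_add_mul 2 fun q q' => ?_)
  have h1 : ∫ x, maxProfit V q x ∂(μ : Measure X)
      ≤ ∫ x, (maxProfit V q' x + ‖q - q'‖) ∂(μ : Measure X) :=
    integral_mono (integrable_of_continuous (lipschitzWith_maxProfit hV hL q).continuous _)
      ((integrable_of_continuous (lipschitzWith_maxProfit hV hL q').continuous _).add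
        (integrable_const _)) fun x => maxProfit_le_add_norm hV q q' x
  rw [integral_add (integrable_of_continuous (lipschitzWith_maxProfit hV hL q').continuous _)
    (integrable_const _)] at h1
  have h2 := (abs_le.1 (abs_integral_sub_le q q' ν)).2
  simp only [dualValue, dist_eq_norm]
  simp at h1 ⊢
  linarith

theorem isCompact_lipschitz_normalized (K : NNReal) (y₀ : Y) :
    IsCompact {q : C(Y, ℝ) | LipschitzWith K q ∧ q y₀ = 0} := by
  apply ArzelaAscoli.isCompact_of_equicontinuous
  · have himg : ContinuousMap.toFun '' {q : C(Y, ℝ) | LipschitzWith K q ∧ q y₀ = 0}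
        = {f : Y → ℝ | LipschitzWith K f ∧ f y₀ = 0} := by
      ext f
      constructor
      · rintro ⟨q, hq, rfl⟩
        exact hq
      · rintro ⟨h1, h2⟩
        exact ⟨⟨f, h1.continuous⟩, ⟨h1, h2⟩, rfl⟩
    rw [himg]
    -- The normalization at `y₀` confines the value at `y` to a ball of radius `K * dist y y₀`.
    refine IsCompact.of_isClosed_subset
      (isCompact_univ_pi fun y => isCompact_closedBall (0 : ℝ) (K * dist y y₀)) ?_ ?_
    · simp only [lipschitzWith_iff_dist_le_mul, ofPred_and, ofPred_forall]
      refine IsClosed.inter (isClosed_iInter fun x => isClosed_iInter fun y =>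
        isClosed_le ?_ continuous_const) (isClosed_eq (continuous_apply y₀) continuous_const)
      exact (continuous_apply x).dist (continuous_apply y)
    · rintro f ⟨h1, h2⟩ y -
      have := h1.dist_le_mul y y₀
      rwa [h2] at this
  · exact (LipschitzWith.uniformEquicontinuous _ K fun q => q.2.1).equicontinuous

theorem exists_minimizer_dualValue
    (hV : Continuous fun w : X × ProbabilityMeasure Y => V w.1 w.2)
    {L : NNReal} (hL : ∀ η, LipschitzWith L fun x => V x η) {K : NNReal}
    (himp : ∀ q : C(Y, ℝ), ∃ q' : C(Y, ℝ), LipschitzWith K q' ∧ (∀ y, q' y ≤ q y) ∧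
      ∀ x, maxProfit V q' x ≤ maxProfit V q x) :
    ∃ q : C(Y, ℝ), LipschitzWith K q ∧ ∀ q', dualValue V μ ν q ≤ dualValue V μ ν q' := by
  let y₀ := Classical.arbitrary Y
  obtain ⟨q, hq, hmin⟩ := (isCompact_lipschitz_normalized K y₀).exists_isMinOn
    ⟨0, LipschitzWith.const' (α := Y) (K := K) (0 : ℝ), rfl⟩
    (continuous_dualValue (μ := μ) (ν := ν) hV hL).continuousOn
  refine ⟨q, hq.1, fun q' => ?_⟩
  obtain ⟨q₁, h1, h2, h3⟩ := himp q'
  have h4 : dualValue V μ ν q₁ ≤ dualValue V μ ν q' :=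
    add_le_add
      (integral_mono (integrable_of_continuous (lipschitzWith_maxProfit hV hL q₁).continuous _)
        (integrable_of_continuous (lipschitzWith_maxProfit hV hL q').continuous _) h3)
      (integral_mono (integrable_of_continuous q₁.continuous _)
        (integrable_of_continuous q'.continuous _) h2)
  refine le_trans ?_ h4
  rw [← dualValue_sub_const hV hL q₁ (q₁ y₀)]
  refine hmin ⟨?_, by simp⟩
  refine LipschitzWith.of_dist_le_mul fun x y => ?_
  simpa using h1.dist_le_mul x y

end Duality

/-! ### Almost surely unique optimal workforces yield a unique equilibrium. -/

section Assignments

set_option linter.unusedSectionVars false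

open Topology Filter

variable {X Y : Type*} [MetricSpace X] [CompactSpace X] [MeasurableSpace X] [BorelSpace X]
  [MetricSpace Y] [CompactSpace Y] [MeasurableSpace Y] [BorelSpace Y] [Nonempty Y]
  {V : X → ProbabilityMeasure Y → ℝ} {μ : ProbabilityMeasure X} {ν : ProbabilityMeasure Y}

theorem profit_add_smul (q h : C(Y, ℝ)) (t : ℝ) (x : X) (η : ProbabilityMeasure Y) :
    profit V (q + t • h) x η = profit V q x η - t * ∫ y, h y ∂(η : Measure Y) := by
  simp only [profit, ContinuousMap.add_apply, ContinuousMap.smul_apply, smul_eq_mul]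
  rw [integral_add (integrable_of_continuous q.continuous _)
    ((integrable_of_continuous h.continuous _).const_mul t), integral_const_mul]
  ring

/-- By continuity every cluster point is optimal, hence equal to `η`; compactness then forces
convergence. -/
theorem tendsto_of_tendsto_profit (hV : Continuous fun w : X × ProbabilityMeasure Y => V w.1 w.2)
    {q : C(Y, ℝ)} {x : X} {η : ProbabilityMeasure Y} (hη : η ∈ optimalWorkforces V q x)
    (hx : (optimalWorkforces V q x).Subsingleton) {ι : Type*} {l : Filter ι}
    {u : ι → ProbabilityMeasure Y}
    (hu : Tendsto (fun i => profit V q x (u i)) l (𝓝 (maxProfit V q x))) :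
    Tendsto u l (𝓝 η) := by
  refine isCompact_univ.tendsto_nhds_of_unique_mapClusterPt (by simp) ?_
  intro η' _ hη'
  refine hx ?_ hη
  have hc : Continuous fun η => profit V q x η :=
    (continuous_profit hV q).comp (Continuous.prodMk_right x)
  have h1 : MapClusterPt (profit V q x η') l (fun i => profit V q x (u i)) :=
    hη'.continuousAt_comp hc.continuousAt
  have h2 : profit V q x η' = maxProfit V q x :=
    @eq_of_nhds_neBot _ _ _ _ _ (NeBot.mono h1 (inf_le_inf_left _ hu))
  intro η''
  rw [h2]
  exact profit_le_maxProfit hV q x η''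

/-- Envelope theorem: the slope is at least `-∫ h dη` because `η` stays feasible, and at most `-∫ h
d(u n)` for the perturbed optimum `u n`, which converges to `η`. -/
theorem tendsto_slope_maxProfit
    (hV : Continuous fun w : X × ProbabilityMeasure Y => V w.1 w.2)
    {q : C(Y, ℝ)} (h : C(Y, ℝ)) {x : X} {η : ProbabilityMeasure Y}
    (hη : η ∈ optimalWorkforces V q x) (hx : (optimalWorkforces V q x).Subsingleton)
    {t : ℕ → ℝ} (ht : ∀ n, 0 < t n) (ht0 : Tendsto t atTop (𝓝 0)) :
    Tendsto (fun n => (maxProfit V (q + t n • h) x - maxProfit V q x) / t n) atTop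
      (𝓝 (-∫ y, h y ∂(η : Measure Y))) := by
  choose u hu using fun n => nonempty_optimalWorkforces hV (q + t n • h) x
  have hint : ∀ η : ProbabilityMeasure Y, |∫ y, h y ∂(η : Measure Y)| ≤ ‖h‖ := fun η => by
    simpa using abs_integral_sub_le h 0 η
  have hlow : ∀ n, maxProfit V q x - t n * ∫ y, h y ∂(η : Measure Y)
      ≤ maxProfit V (q + t n • h) x := fun n => by
    rw [maxProfit_eq hη, ← profit_add_smul]
    exact profit_le_maxProfit hV _ _ _
  have hup : ∀ n, maxProfit V (q + t n • h) x
      = profit V q x (u n) - t n * ∫ y, h y ∂(u n : Measure Y) := fun n => by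
    rw [maxProfit_eq (hu n), profit_add_smul]
  have hconv : Tendsto u atTop (𝓝 η) := by
    refine tendsto_of_tendsto_profit hV hη hx ?_
    -- One `‖h‖` bounds the wage change of `η`, the other that of `u n`.
    have hz : Tendsto (fun n => maxProfit V q x - t n * (2 * ‖h‖)) atTop
        (𝓝 (maxProfit V q x)) := by
      simpa using (tendsto_const_nhds (x := maxProfit V q x)).sub (ht0.mul_const (2 * ‖h‖))
    refine tendsto_of_tendsto_of_tendsto_of_le_of_le hz tendsto_const_nhds (fun n => ?_)
      fun n => profit_le_maxProfit hV q x (u n)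
    have h1 := hlow n
    rw [hup n] at h1
    have h2 := mul_le_mul_of_nonneg_left (abs_le.1 (hint η)).2 (ht n).le
    have h3 := mul_le_mul_of_nonneg_left (abs_le.1 (hint (u n))).1 (ht n).le
    simp only
    linarith
  have hlim : Tendsto (fun n => -∫ y, h y ∂(u n : Measure Y)) atTop
      (𝓝 (-∫ y, h y ∂(η : Measure Y))) :=
    (((ProbabilityMeasure.continuous_integral_continuousMap h).tendsto η).comp hconv).neg
  refine tendsto_of_tendsto_of_tendsto_of_le_of_le tendsto_const_nhds hlim
    (fun n => ?_) fun n => ?_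
  · simp only
    rw [le_div_iff₀ (ht n)]
    linarith [hlow n]
  · simp only
    rw [div_le_iff₀ (ht n)]
    linarith [hup n, profit_le_maxProfit hV q x (u n)]

/-- At a minimizer the right derivative of the dual objective in direction `h` is nonnegative; the
envelope theorem and dominated convergence compute it. -/
theorem integral_integral_optimal_le
    (hV : Continuous fun w : X × ProbabilityMeasure Y => V w.1 w.2)
    {L : NNReal} (hL : ∀ η, LipschitzWith L fun x => V x η) {q : C(Y, ℝ)}
    (hq : ∀ q', dualValue V μ ν q ≤ dualValue V μ ν q') {e : X → ProbabilityMeasure Y}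
    (he : ∀ᵐ x ∂(μ : Measure X), e x ∈ optimalWorkforces V q x)
    (hs : ∀ᵐ x ∂(μ : Measure X), (optimalWorkforces V q x).Subsingleton) (h : C(Y, ℝ)) :
    ∫ x, ∫ y, h y ∂(e x : Measure Y) ∂(μ : Measure X) ≤ ∫ y, h y ∂(ν : Measure Y) := by
  let t : ℕ → ℝ := fun n => 1 / ((n : ℝ) + 1)
  have ht : ∀ n, 0 < t n := fun n => Nat.one_div_pos_of_nat
  have ht0 : Tendsto t atTop (𝓝 0) := tendsto_one_div_add_atTop_nhds_zero_nat
  have hc : ∀ q, Continuous (maxProfit V q) := fun q => (lipschitzWith_maxProfit hV hL q).continuous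
  have hi : ∀ q, Integrable (maxProfit V q) (μ : Measure X) := fun q =>
    integrable_of_continuous (hc q) _
  have hlim : Tendsto (fun n => ∫ x, (maxProfit V (q + t n • h) x - maxProfit V q x) / t n
      ∂(μ : Measure X)) atTop (𝓝 (∫ x, -∫ y, h y ∂(e x : Measure Y) ∂(μ : Measure X))) := by
    refine tendsto_integral_of_dominated_convergence (fun _ => ‖h‖)
      (fun n => (((hc _).sub (hc _)).div_const _).aestronglyMeasurable) (integrable_const _)
      (fun n => Eventually.of_forall fun x => ?_) ?_
    · have hn : ‖t n • h‖ = t n * ‖h‖ := by rw [norm_smul, Real.norm_of_nonneg (ht n).le]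
      have h1 := maxProfit_le_add_norm hV (q + t n • h) q x
      have h2 := maxProfit_le_add_norm hV q (q + t n • h) x
      rw [show q + t n • h - q = t n • h by abel, hn] at h1
      rw [show q - (q + t n • h) = -(t n • h) by abel, norm_neg, hn] at h2
      rw [norm_div, Real.norm_of_nonneg (ht n).le, div_le_iff₀ (ht n), Real.norm_eq_abs, abs_le]
      constructor <;> linarith
    · filter_upwards [he, hs] with x hx hx'
      exact tendsto_slope_maxProfit hV h hx hx' ht ht0
  rw [integral_neg] at hlim
  have hge : ∀ n, -∫ y, h y ∂(ν : Measure Y) ≤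
      ∫ x, (maxProfit V (q + t n • h) x - maxProfit V q x) / t n ∂(μ : Measure X) := by
    intro n
    rw [integral_div, integral_sub (hi _) (hi _), le_div_iff₀ (ht n)]
    have h1 := hq (q + t n • h)
    simp only [dualValue, ContinuousMap.add_apply, ContinuousMap.smul_apply, smul_eq_mul] at h1
    rw [integral_add (integrable_of_continuous q.continuous _)
      ((integrable_of_continuous h.continuous _).const_mul _), integral_const_mul] at h1
    linarith
  linarith [ge_of_tendsto' hlim hge]

/-- On `Xs` the preimage of a closed set is the projection of a compact part of the graph, hence
closed relative to `Xs`. Off `Xs` a constant workforce is used. -/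
theorem exists_measurable_selection
    (hV : Continuous fun w : X × ProbabilityMeasure Y => V w.1 w.2) (q : C(Y, ℝ)) {Xs : Set X}
    (hXs : MeasurableSet Xs) (hs : ∀ x ∈ Xs, (optimalWorkforces V q x).Subsingleton) :
    ∃ e : X → ProbabilityMeasure Y, Measurable e ∧ ∀ x ∈ Xs, e x ∈ optimalWorkforces V q x := by
  classical
  choose o ho using nonempty_optimalWorkforces hV q
  let η₀ : ProbabilityMeasure Y := ⟨Measure.dirac (Classical.arbitrary Y), inferInstance⟩
  refine ⟨fun x => if x ∈ Xs then o x else η₀, ?_, fun x hx => by simpa [hx] using ho x⟩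
  refine measurable_of_isClosed fun C hC => ?_
  have hcl : IsClosed (Prod.fst '' ({w : X × ProbabilityMeasure Y |
      w.2 ∈ optimalWorkforces V q w.1} ∩ Prod.snd ⁻¹' C)) :=
    (((isClosed_graph_optimalWorkforces hV q).inter
      (hC.preimage continuous_snd)).isCompact.image continuous_fst).isClosed
  have : (fun x => if x ∈ Xs then o x else η₀) ⁻¹' C
      = (Xs ∩ Prod.fst '' ({w : X × ProbabilityMeasure Y |
      w.2 ∈ optimalWorkforces V q w.1} ∩ Prod.snd ⁻¹' C)) ∪ (Xsᶜ ∩ {_x | η₀ ∈ C}) := by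
    ext x
    by_cases hx : x ∈ Xs
    · simp only [mem_preimage, hx, if_true, mem_union, mem_inter_iff, true_and, mem_compl_iff,
        not_true_eq_false, false_and, or_false]
      constructor
      · exact fun h => ⟨(x, o x), ⟨ho x, h⟩, rfl⟩
      · rintro ⟨⟨x', η⟩, ⟨h1, h2⟩, rfl⟩
        rwa [hs x' hx (ho x') h1]
    · simp [hx]
  rw [this]
  exact (hXs.inter hcl.measurableSet).union (hXs.compl.inter (MeasurableSet.const _))

/-- Up to a null set, a closed `C` is the cylinder over the projection of `C ∩ G`, so its measure is
determined by `μ`. -/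
theorem measure_eq_of_graph {G : Set (X × ProbabilityMeasure Y)} (hG : IsClosed G) {Xs : Set X}
    (hinj : ∀ x ∈ Xs, ∀ η η', (x, η) ∈ G → (x, η') ∈ G → η = η')
    (hμ : ∀ᵐ x ∂(μ : Measure X), x ∈ Xs) {γ γ' : ProbabilityMeasure (X × ProbabilityMeasure Y)}
    (h1 : (γ : Measure (X × ProbabilityMeasure Y)).map Prod.fst = (μ : Measure X))
    (h1' : (γ' : Measure (X × ProbabilityMeasure Y)).map Prod.fst = (μ : Measure X))
    (h2 : ∀ᵐ w ∂(γ : Measure (X × ProbabilityMeasure Y)), w ∈ G)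
    (h2' : ∀ᵐ w ∂(γ' : Measure (X × ProbabilityMeasure Y)), w ∈ G) : γ = γ' := by
  have key : ∀ {γ : ProbabilityMeasure (X × ProbabilityMeasure Y)},
      (γ : Measure (X × ProbabilityMeasure Y)).map Prod.fst = (μ : Measure X) →
      (∀ᵐ w ∂(γ : Measure (X × ProbabilityMeasure Y)), w ∈ G) →
      ∀ C, IsClosed C → (γ : Measure (X × ProbabilityMeasure Y)) C
        = (μ : Measure X) (Prod.fst '' (C ∩ G)) := by
    intro γ h1 h2 C hC
    have hcl : IsClosed (Prod.fst '' (C ∩ G)) :=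
      ((hC.inter hG).isCompact.image continuous_fst).isClosed
    rw [← h1, Measure.map_apply measurable_fst hcl.measurableSet]
    have h3 : ∀ᵐ w ∂(γ : Measure (X × ProbabilityMeasure Y)), w.1 ∈ Xs := by
      rw [← h1] at hμ
      exact ae_of_ae_map measurable_fst.aemeasurable hμ
    refine measure_congr ?_
    filter_upwards [h2, h3] with w hw hw'
    refine propext ⟨fun h => ⟨w, ⟨h, hw⟩, rfl⟩, ?_⟩
    rintro ⟨w', ⟨ha, hb⟩, hc⟩
    have : w' = w := Prod.ext hc (hinj w.1 hw' _ _ (hc ▸ hb) hw)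
    exact this ▸ ha
  apply ProbabilityMeasure.toMeasure_injective
  refine ext_of_generate_finite _ (BorelSpace.measurable_eq.trans borel_eq_generateFrom_isClosed)
    isPiSystem_isClosed (fun C hC => ?_) (by simp)
  rw [key h1 h2 C hC, key h1' h2' C hC]

theorem integral_bind_kernel {α β : Type*} [MeasurableSpace α] [MeasurableSpace β] {m : Measure α}
    {κ : ProbabilityTheory.Kernel α β} {f : β → ℝ} (hf : Integrable f (m.bind κ)) :
    ∫ y, f y ∂(m.bind κ) = ∫ x, ∫ y, f y ∂(κ x) ∂m := by
  have h := ProbabilityTheory.Kernel.integral_comp (κ := ProbabilityTheory.Kernel.const Unit m)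
    (η := κ) (a := ()) (f := f)
  simp only [ProbabilityTheory.Kernel.comp_apply, ProbabilityTheory.Kernel.const_apply] at h
  exact h hf

theorem IsAssignment.integral_mean {γ : ProbabilityMeasure (X × ProbabilityMeasure Y)}
    (hγ : IsAssignment μ ν γ) (q : C(Y, ℝ)) :
    ∫ w, ∫ y, q y ∂(w.2 : Measure Y) ∂(γ : Measure (X × ProbabilityMeasure Y))
      = ∫ y, q y ∂(ν : Measure Y) := by
  let κ : ProbabilityTheory.Kernel (X × ProbabilityMeasure Y) Y :=
    ⟨fun w => (w.2 : Measure Y), measurable_toMeasure.comp measurable_snd⟩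
  have hκ : (γ : Measure (X × ProbabilityMeasure Y)).bind κ = (ν : Measure Y) := by
    ext A hA
    rw [Measure.bind_apply hA κ.aemeasurable]
    exact hγ.mean_workforce A hA
  rw [← hκ, integral_bind_kernel (hκ ▸ integrable_of_continuous q.continuous _)]
  rfl

theorem IsAssignment.integral_fst {γ : ProbabilityMeasure (X × ProbabilityMeasure Y)}
    (hγ : IsAssignment μ ν γ) {p : X → ℝ} (hp : Continuous p) :
    ∫ w, p w.1 ∂(γ : Measure (X × ProbabilityMeasure Y)) = ∫ x, p x ∂(μ : Measure X) := by
  rw [← hγ.firm_marginal, integral_map measurable_fst.aemeasurable hp.aestronglyMeasurable]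

theorem IsAssignment.integral_prices {γ : ProbabilityMeasure (X × ProbabilityMeasure Y)}
    (hγ : IsAssignment μ ν γ) {p : X → ℝ} (hp : Continuous p) (q : C(Y, ℝ)) :
    ∫ w, (p w.1 + ∫ y, q y ∂(w.2 : Measure Y)) ∂(γ : Measure (X × ProbabilityMeasure Y))
      = ∫ x, p x ∂(μ : Measure X) + ∫ y, q y ∂(ν : Measure Y) := by
  rw [← hγ.integral_fst hp, ← hγ.integral_mean q]
  exact integral_add (integrable_of_continuous (hp.comp continuous_fst) _)
    (integrable_of_continuous ((ProbabilityMeasure.continuous_integral_continuousMap q).comp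
      continuous_snd) _)

/-- Every equilibrium assignment is concentrated on the optimal workforces for any wages that
minimize the dual objective. -/
theorem IsEquilibriumAssignment.ae_mem_optimalWorkforces
    (hV : Continuous fun w : X × ProbabilityMeasure Y => V w.1 w.2)
    {L : NNReal} (hL : ∀ η, LipschitzWith L fun x => V x η) {q : C(Y, ℝ)}
    (hq : ∀ q', dualValue V μ ν q ≤ dualValue V μ ν q')
    {γ : ProbabilityMeasure (X × ProbabilityMeasure Y)}
    (hγ : IsEquilibriumAssignment V μ ν γ) :
    ∀ᵐ w ∂(γ : Measure (X × ProbabilityMeasure Y)), w.2 ∈ optimalWorkforces V q w.1 := by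
  obtain ⟨p', q', h⟩ := hγ
  obtain ⟨Kp, hKp⟩ := h.lipschitz_p
  obtain ⟨Kq, hKq⟩ := h.lipschitz_q
  let Q : C(Y, ℝ) := ⟨q', hKq.continuous⟩
  have hVi : Integrable (fun w => V w.1 w.2) (γ : Measure (X × ProbabilityMeasure Y)) :=
    integrable_of_continuous hV _
  have e1 : ∫ w, V w.1 w.2 ∂(γ : Measure (X × ProbabilityMeasure Y))
      = ∫ x, p' x ∂(μ : Measure X) + ∫ y, Q y ∂(ν : Measure Y) := by
    rw [← h.assignment.integral_prices hKp.continuous Q]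
    refine integral_congr_ae ?_
    filter_upwards [Measure.support_mem_ae (μ := (γ : Measure (X × ProbabilityMeasure Y)))]
      with w hw
    exact (h.profit_eq w hw).symm
  have e2 : dualValue V μ ν Q ≤ ∫ w, V w.1 w.2 ∂(γ : Measure (X × ProbabilityMeasure Y)) := by
    rw [e1, dualValue]
    gcongr
    · exact integrable_of_continuous (lipschitzWith_maxProfit hV hL Q).continuous _
    · exact integrable_of_continuous hKp.continuous _
    · refine fun x => maxProfit_le hV fun η => ?_
      have := h.profit_ge x η
      simp only [profit]
      change V x η - ∫ y, q' y ∂(η : Measure Y) ≤ p' x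
      linarith
  have hcp := (lipschitzWith_maxProfit hV hL q).continuous
  have e3 := h.assignment.integral_prices hcp q
  -- Complementary slackness: the nonnegative loss `g` has integral `dualValue q - ∫ V`, which is at
  -- most zero because `dualValue q ≤ dualValue Q ≤ ∫ V`.
  let g : X × ProbabilityMeasure Y → ℝ := fun w => maxProfit V q w.1 - profit V q w.1 w.2
  have hgc : Continuous g := (hcp.comp continuous_fst).sub (continuous_profit hV q)
  have hg0 : ∀ w, 0 ≤ g w := fun w => sub_nonneg.2 (profit_le_maxProfit hV q _ _)
  have hgi : ∫ w, g w ∂(γ : Measure (X × ProbabilityMeasure Y)) ≤ 0 := by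
    have : ∀ w, g w = (maxProfit V q w.1 + ∫ y, q y ∂(w.2 : Measure Y)) - V w.1 w.2 :=
      fun w => by simp only [g, profit]; ring
    simp_rw [this]
    rw [integral_sub _ hVi, e3]
    · have := hq Q
      rw [dualValue] at this
      linarith
    · exact integrable_of_continuous ((hcp.comp continuous_fst).add
        ((ProbabilityMeasure.continuous_integral_continuousMap q).comp continuous_snd)) _
  have hgz := (integral_eq_zero_iff_of_nonneg hg0 (integrable_of_continuous hgc _)).1
    (le_antisymm hgi (integral_nonneg hg0))
  filter_upwards [hgz] with w hw η'
  have : g w = 0 := hw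
  simp only [g] at this
  linarith [profit_le_maxProfit hV q w.1 η']

/-- If some dual solution has almost surely unique optimal workforces then there is exactly one
equilibrium assignment. -/
theorem exists_unique_equilibriumAssignment
    (hV : Continuous fun w : X × ProbabilityMeasure Y => V w.1 w.2)
    {L : NNReal} (hL : ∀ η, LipschitzWith L fun x => V x η) {K : NNReal} {q : C(Y, ℝ)}
    (hqK : LipschitzWith K q) (hq : ∀ q', dualValue V μ ν q ≤ dualValue V μ ν q') {Xs : Set X}
    (hXs : MeasurableSet Xs) (hμ : ∀ᵐ x ∂(μ : Measure X), x ∈ Xs)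
    (hs : ∀ x ∈ Xs, (optimalWorkforces V q x).Subsingleton) :
    ∃ γ : ProbabilityMeasure (X × ProbabilityMeasure Y),
      IsEquilibriumAssignment V μ ν γ ∧ (∀ γ', IsEquilibriumAssignment V μ ν γ' → γ' = γ) ∧
      ∀ w ∈ (γ : Measure (X × ProbabilityMeasure Y)).support, w.2 ∈ optimalWorkforces V q w.1 := by
  obtain ⟨e, hem, he⟩ := exists_measurable_selection hV q hXs hs
  have hae : ∀ᵐ x ∂(μ : Measure X), e x ∈ optimalWorkforces V q x := hμ.mono he
  have hfm : Measurable fun x => (x, e x) := measurable_id.prodMk hem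
  let γ : ProbabilityMeasure (X × ProbabilityMeasure Y) := μ.map hfm.aemeasurable
  have hγ : (γ : Measure (X × ProbabilityMeasure Y))
      = (μ : Measure X).map fun x => (x, e x) := rfl
  -- Market clearing: the one-sided inequality is applied to both `h` and `-h`.
  have hmean : ∀ h : C(Y, ℝ), ∫ x, ∫ y, h y ∂(e x : Measure Y) ∂(μ : Measure X)
      = ∫ y, h y ∂(ν : Measure Y) := by
    intro h
    have h1 := integral_integral_optimal_le hV hL hq hae (hμ.mono hs) h
    have h2 := integral_integral_optimal_le hV hL hq hae (hμ.mono hs) (-h)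
    simp only [ContinuousMap.neg_apply, integral_neg] at h2
    linarith
  let κ : ProbabilityTheory.Kernel X Y :=
    ⟨fun x => (e x : Measure Y), measurable_toMeasure.comp hem⟩
  have hκp : ProbabilityTheory.IsMarkovKernel κ := ⟨fun x => inferInstanceAs
    (IsProbabilityMeasure (e x : Measure Y))⟩
  have hκ : (μ : Measure X).bind κ = (ν : Measure Y) := by
    refine ext_of_forall_integral_eq_of_IsFiniteMeasure fun f => ?_
    rw [integral_bind_kernel (integrable_of_continuous f.continuous _)]
    exact hmean f.toContinuousMap
  have hassign : IsAssignment μ ν γ := by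
    constructor
    · rw [hγ, Measure.map_map measurable_fst hfm]
      exact Measure.map_id
    · intro A hA
      rw [← hκ, Measure.bind_apply hA κ.aemeasurable]
      exact lintegral_map ((Measure.measurable_coe hA).comp
        (measurable_toMeasure.comp measurable_snd)) hfm
  have hsupp : ∀ w ∈ (γ : Measure (X × ProbabilityMeasure Y)).support,
      w.2 ∈ optimalWorkforces V q w.1 := by
    refine fun w hw => Measure.support_subset_of_isClosed
      (isClosed_graph_optimalWorkforces hV q) ?_ hw
    rw [hγ, mem_ae_map_iff hfm.aemeasurable (isClosed_graph_optimalWorkforces hV q).measurableSet]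
    exact hae
  have heq : IsEquilibriumAssignment V μ ν γ := by
    refine ⟨maxProfit V q, q, hassign, ⟨L, lipschitzWith_maxProfit hV hL q⟩, ⟨K, hqK⟩, ?_, ?_⟩
    · intro w hw
      rw [maxProfit_eq (hsupp w hw), profit]
      ring
    · intro x η
      have := profit_le_maxProfit hV q x η
      rw [profit] at this
      linarith
  refine ⟨γ, heq, fun γ' hγ' => ?_, hsupp⟩
  exact measure_eq_of_graph (isClosed_graph_optimalWorkforces hV q)
    (fun x hx η η' h h' => hs x hx h h') hμ hγ'.choose_spec.choose_spec.assignment.firm_marginal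
    hassign.firm_marginal (hγ'.ae_mem_optimalWorkforces hV hL hq)
    (heq.ae_mem_optimalWorkforces hV hL hq)

end Assignments

/-! ### Optimal workforces when output depends on a single moment. -/

section MomentCase

set_option linter.unusedSectionVars false

open Topology Filter

theorem exists_mixture {Y : Type*} [MeasurableSpace Y] (η η' : ProbabilityMeasure Y) {t : ℝ}
    (ht : t ∈ Icc (0 : ℝ) 1) :
    ∃ η'' : ProbabilityMeasure Y, ∀ f : Y → ℝ, Integrable f (η : Measure Y) →
      Integrable f (η' : Measure Y) → ∫ y, f y ∂(η'' : Measure Y)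
        = (1 - t) * ∫ y, f y ∂(η : Measure Y) + t * ∫ y, f y ∂(η' : Measure Y) := by
  have h1 : 0 ≤ 1 - t := sub_nonneg.2 ht.2
  refine ⟨⟨ENNReal.ofReal (1 - t) • (η : Measure Y) + ENNReal.ofReal t • (η' : Measure Y), ⟨?_⟩⟩,
    fun f hf hf' => ?_⟩
  · simp [← ENNReal.ofReal_add h1 ht.1]
  · change ∫ y, f y ∂(ENNReal.ofReal (1 - t) • (η : Measure Y)
      + ENNReal.ofReal t • (η' : Measure Y)) = _
    rw [integral_add_measure (hf.smul_measure ENNReal.ofReal_ne_top)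
      (hf'.smul_measure ENNReal.ofReal_ne_top), integral_smul_measure, integral_smul_measure,
      ENNReal.toReal_ofReal h1, ENNReal.toReal_ofReal ht.1]
    rfl

variable {X Y : Type*} [MetricSpace X] [CompactSpace X] [MeasurableSpace X] [BorelSpace X]
  [MetricSpace Y] [CompactSpace Y] [MeasurableSpace Y] [BorelSpace Y] [Nonempty Y]
  {u : X → ℝ → ℝ} {M : X → C(Y, ℝ)}

/-- The output `u x (E_η[M x])`. -/
noncomputable def momentOutput (u : X → ℝ → ℝ) (M : X → C(Y, ℝ)) (x : X)
    (η : ProbabilityMeasure Y) : ℝ :=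
  u x (∫ y, M x y ∂(η : Measure Y))

theorem profit_moment_mixture {q : C(Y, ℝ)} {x : X} {η η' : ProbabilityMeasure Y}
    (hη : η ∈ optimalWorkforces (momentOutput u M) q x) {t : ℝ}
    (ht : t ∈ Icc (0 : ℝ) 1) :
    u x ((1 - t) * ∫ y, M x y ∂(η : Measure Y) + t * ∫ y, M x y ∂(η' : Measure Y))
      - ((1 - t) * ∫ y, q y ∂(η : Measure Y) + t * ∫ y, q y ∂(η' : Measure Y))
      ≤ u x (∫ y, M x y ∂(η : Measure Y)) - ∫ y, q y ∂(η : Measure Y) := by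
  obtain ⟨η'', h⟩ := exists_mixture η η' ht
  have := hη η''
  simp only [profit, momentOutput] at this
  rwa [h _ (integrable_of_continuous (M x).continuous _) (integrable_of_continuous
    (M x).continuous _), h _ (integrable_of_continuous q.continuous _)
    (integrable_of_continuous q.continuous _)] at this

/-- Moving a small mass `t` of the workforce to the single type `y₀` cannot raise profit; this is
the right derivative at `t = 0`. -/
theorem first_order_condition (hd : ∀ x, Differentiable ℝ (u x)) {q : C(Y, ℝ)} {x : X}
    {η : ProbabilityMeasure Y}
    (hη : η ∈ optimalWorkforces (momentOutput u M) q x) (y₀ : Y) :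
    deriv (u x) (∫ y, M x y ∂(η : Measure Y)) * M x y₀ - q y₀
      ≤ deriv (u x) (∫ y, M x y ∂(η : Measure Y)) * ∫ y, M x y ∂(η : Measure Y)
        - ∫ y, q y ∂(η : Measure Y) := by
  set z := ∫ y, M x y ∂(η : Measure Y)
  set Q := ∫ y, q y ∂(η : Measure Y)
  let δ : ProbabilityMeasure Y := ⟨Measure.dirac y₀, inferInstance⟩
  have hMδ : ∫ y, M x y ∂(δ : Measure Y) = M x y₀ := integral_dirac _ _
  have hqδ : ∫ y, q y ∂(δ : Measure Y) = q y₀ := integral_dirac _ _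
  let g : ℝ → ℝ := fun t => u x ((1 - t) * z + t * M x y₀) - ((1 - t) * Q + t * q y₀)
  have hlin : ∀ A B : ℝ, HasDerivAt (fun t : ℝ => (1 - t) * A + t * B) (B - A) 0 := by
    intro A B
    have h1 := (((hasDerivAt_id (0 : ℝ)).const_sub 1).mul_const A).add
      ((hasDerivAt_id (0 : ℝ)).mul_const B)
    exact h1.congr_deriv (by ring)
  have hu : HasDerivAt (u x) (deriv (u x) z) ((1 - 0) * z + 0 * M x y₀) := by
    simpa using ((hd x) z).hasDerivAt
  have hg : HasDerivAt g (deriv (u x) z * (M x y₀ - z) - (q y₀ - Q)) 0 :=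
    (hu.comp 0 (hlin z (M x y₀))).sub (hlin Q (q y₀))
  have hle : deriv (u x) z * (M x y₀ - z) - (q y₀ - Q) ≤ 0 := by
    refine le_of_tendsto hg.tendsto_slope_zero_right ?_
    filter_upwards [Ioo_mem_nhdsGT (zero_lt_one' ℝ)] with t ht
    have h1 := profit_moment_mixture (η' := δ) hη ⟨ht.1.le, ht.2.le⟩
    rw [hMδ, hqδ] at h1
    have h2 : g (0 + t) - g 0 ≤ 0 := by
      simp only [g, zero_add, sub_zero, one_mul, zero_mul, add_zero]
      linarith
    rw [smul_eq_mul]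
    exact mul_nonpos_of_nonneg_of_nonpos (inv_nonneg.2 ht.1.le) h2
  linarith

/-- With two different moments, the equal mixture of the workforces would earn strictly more. -/
theorem optimal_moment_unique (hc : ∀ x, StrictConcaveOn ℝ univ (u x)) {q : C(Y, ℝ)} {x : X}
    {η η' : ProbabilityMeasure Y}
    (hη : η ∈ optimalWorkforces (momentOutput u M) q x)
    (hη' : η' ∈ optimalWorkforces (momentOutput u M) q x) :
    ∫ y, M x y ∂(η : Measure Y) = ∫ y, M x y ∂(η' : Measure Y) := by
  by_contra hne
  have h1 := profit_moment_mixture (η' := η') hη (t := 1 / 2) ⟨by norm_num, by norm_num⟩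
  obtain ⟨-, hcx⟩ := hc x
  have h2 := hcx (mem_univ _) (mem_univ _) hne (by norm_num : (0 : ℝ) < 1 - 1 / 2)
    (by norm_num : (0 : ℝ) < 1 / 2) (by norm_num)
  have h3 := hη' η
  simp only [smul_eq_mul, profit, momentOutput] at h1 h2 h3
  linarith

/-- The output, its shadow value `φ`, and the indirect utility `w` of each firm at the optimum. -/
theorem exists_shadow_values
    (hV : Continuous fun w : X × ProbabilityMeasure Y => momentOutput u M w.1 w.2)
    (hc : ∀ x, StrictConcaveOn ℝ univ (u x)) (hd : ∀ x, Differentiable ℝ (u x)) (q : C(Y, ℝ)) :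
    ∃ z w : X → ℝ,
      (∀ x, ∀ η ∈ optimalWorkforces (momentOutput u M) q x,
        ∫ y, M x y ∂(η : Measure Y) = z x ∧
        deriv (u x) (z x) * z x - ∫ y, q y ∂(η : Measure Y) = w x) ∧
      ∀ x y, deriv (u x) (z x) * M x y - q y ≤ w x := by
  choose o ho using nonempty_optimalWorkforces
    (V := momentOutput u M) hV q
  refine ⟨fun x => ∫ y, M x y ∂(o x : Measure Y), fun x =>
    deriv (u x) (∫ y, M x y ∂(o x : Measure Y)) * (∫ y, M x y ∂(o x : Measure Y))
      - ∫ y, q y ∂(o x : Measure Y), fun x η hη => ?_,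
    fun x y => first_order_condition hd (ho x) y⟩
  have hz := optimal_moment_unique hc hη (ho x)
  refine ⟨hz, ?_⟩
  have h1 := hη (o x)
  have h2 := ho x η
  simp only [profit, momentOutput, hz] at h1 h2
  simp only
  linarith

theorem le_tangent (hc : ∀ x, StrictConcaveOn ℝ univ (u x)) (hd : ∀ x, Differentiable ℝ (u x))
    (x : X) (z z' : ℝ) : u x z' ≤ u x z + deriv (u x) z * (z' - z) := by
  have hcc := (hc x).concaveOn
  rcases lt_trichotomy z' z with h | h | h
  · have := hcc.le_slope_of_hasDerivAt (mem_univ _) (mem_univ _) h ((hd x) z).hasDerivAt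
    rw [slope_def_field, le_div_iff₀ (sub_pos.2 h)] at this
    linarith
  · simp [h]
  · have := hcc.slope_le_of_hasDerivAt (mem_univ _) (mem_univ _) h ((hd x) z).hasDerivAt
    rw [slope_def_field, div_le_iff₀ (sub_pos.2 h)] at this
    linarith

/-- Pay each type only the highest bid `sup_x (φ x * M x y - w x)`. This supremum of uniformly
Lipschitz bids lies below `q` by the first-order condition, and since concave output lies below its
tangent at `z x`, no firm can profit more than before. -/
theorem exists_lipschitz_improvement [Nonempty X]
    (hV : Continuous fun w : X × ProbabilityMeasure Y => momentOutput u M w.1 w.2)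
    (hc : ∀ x, StrictConcaveOn ℝ univ (u x)) (hd : ∀ x, Differentiable ℝ (u x)) {K : NNReal}
    (hK : ∀ (x : X) (η : ProbabilityMeasure Y),
      LipschitzWith K fun y => deriv (u x) (∫ y, M x y ∂(η : Measure Y)) * M x y)
    (q : C(Y, ℝ)) :
    ∃ q' : C(Y, ℝ), LipschitzWith K q' ∧ (∀ y, q' y ≤ q y) ∧
      ∀ x, maxProfit (momentOutput u M) q' x
        ≤ maxProfit (momentOutput u M) q x := by
  obtain ⟨z, w, hzw, hle⟩ := exists_shadow_values hV hc hd q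
  have hne := nonempty_optimalWorkforces (V := momentOutput u M) hV q
  let f : Y → ℝ := fun y => ⨆ x, (deriv (u x) (z x) * M x y - w x)
  have hbdd : ∀ y, BddAbove (range fun x => deriv (u x) (z x) * M x y - w x) := fun y =>
    ⟨q y, by rintro _ ⟨x, rfl⟩; linarith [hle x y]⟩
  have hfK : LipschitzWith K f := by
    refine LipschitzWith.of_le_add_mul K fun y y' => ciSup_le fun x => ?_
    obtain ⟨η, hη⟩ := hne x
    have h1 := hK x η
    rw [(hzw x η hη).1] at h1
    have h2 : _ ≤ f y' := le_ciSup (hbdd y') x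
    linarith [h1.le_add_mul y y']
  refine ⟨⟨f, hfK.continuous⟩, hfK, fun y => ciSup_le fun x => by linarith [hle x y], fun x => ?_⟩
  obtain ⟨η, hη⟩ := hne x
  obtain ⟨h1, h2⟩ := hzw x η hη
  rw [maxProfit_eq hη]
  refine maxProfit_le (V := momentOutput u M) hV fun η' => ?_
  have h3 : deriv (u x) (z x) * (∫ y, M x y ∂(η' : Measure Y)) - w x
      ≤ ∫ y, f y ∂(η' : Measure Y) := by
    have : deriv (u x) (z x) * (∫ y, M x y ∂(η' : Measure Y)) - w x
        = ∫ y, (deriv (u x) (z x) * M x y - w x) ∂(η' : Measure Y) := by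
      rw [integral_sub ((integrable_of_continuous (M x).continuous _).const_mul _)
        (integrable_const _), integral_const_mul]
      simp
    rw [this]
    exact integral_mono (((integrable_of_continuous (M x).continuous _).const_mul _).sub
      (integrable_const _)) (integrable_of_continuous hfK.continuous _)
      fun y => le_ciSup (hbdd y) x
  have h4 := le_tangent hc hd x (z x) (∫ y, M x y ∂(η' : Measure Y))
  simp only [profit, momentOutput, ContinuousMap.coe_mk, h1]
  linarith

/-- The slack in `hle` is nonnegative and has zero mean under `η`. -/
theorem ae_eq_of_optimal {φ z w : ℝ} {q g : C(Y, ℝ)} {η : ProbabilityMeasure Y}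
    (hz : ∫ y, g y ∂(η : Measure Y) = z) (hw : φ * z - ∫ y, q y ∂(η : Measure Y) = w)
    (hle : ∀ y, φ * g y - q y ≤ w) : ∀ᵐ y ∂(η : Measure Y), φ * g y - q y = w := by
  have hi : Integrable (fun y => w - (φ * g y - q y)) (η : Measure Y) :=
    integrable_of_continuous (by fun_prop) _
  have h0 : ∫ y, (w - (φ * g y - q y)) ∂(η : Measure Y) = 0 := by
    rw [integral_sub (integrable_const _) (integrable_of_continuous (by fun_prop) _),
      integral_sub ((integrable_of_continuous g.continuous _).const_mul _)
      (integrable_of_continuous q.continuous _), integral_const_mul, hz, hw]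
    simp
  filter_upwards [(integral_eq_zero_iff_of_nonneg (fun y => sub_nonneg.2 (hle y)) hi).1 h0]
    with y hy
  exact (sub_eq_zero.1 hy).symm

theorem eq_two_point {g : C(Y, ℝ)} {y₁ y₂ : Y} (hg : y₁ ≠ y₂ → g y₁ < g y₂)
    {η : ProbabilityMeasure Y} (hη : ∀ᵐ y ∂(η : Measure Y), y = y₁ ∨ y = y₂) {ρ : ℝ}
    (hρ : ρ = (∫ y, g y ∂(η : Measure Y) - g y₁) / (g y₂ - g y₁)) :
    ρ ∈ Icc (0 : ℝ) 1 ∧ (η : Measure Y) = ENNReal.ofReal (1 - ρ) • Measure.dirac y₁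
      + ENNReal.ofReal ρ • Measure.dirac y₂ := by
  by_cases h : y₁ = y₂
  · subst h
    -- When the two types coincide the quotient is a division by zero, with value `0`.
    have hρ0 : ρ = 0 := by simp [hρ]
    subst hρ0
    refine ⟨by simp, ?_⟩
    ext A hA
    by_cases hy : y₁ ∈ A
    · have : (η : Measure Y) A = 1 :=
        (prob_compl_eq_zero_iff hA).1 (by
          rw [← mem_ae_iff]
          filter_upwards [hη] with y h
          rcases h with rfl | rfl <;> exact hy)
      simp [this, hA, hy]
    · have : (η : Measure Y) A = 0 := by
        rw [← compl_compl A, ← mem_ae_iff]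
        filter_upwards [hη] with y h
        rcases h with rfl | rfl <;> exact hy
      simp [this, hA, hy]
  · have hη2 : (η : Measure Y) = (η : Measure Y) {y₁} • Measure.dirac y₁
        + (η : Measure Y) {y₂} • Measure.dirac y₂ := by
      have h1 : (η : Measure Y).restrict {y₁, y₂} = (η : Measure Y) :=
        Measure.restrict_eq_self_of_ae_mem hη
      rw [← Measure.restrict_singleton, ← Measure.restrict_singleton]
      rw [← Measure.restrict_union (by simpa using h) (measurableSet_singleton _)]
      exact h1.symm
    set s₁ := (η : Measure Y) {y₁}
    set s₂ := (η : Measure Y) {y₂}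
    have hs₁ : s₁ ≠ ⊤ := measure_ne_top _ _
    have hs₂ : s₂ ≠ ⊤ := measure_ne_top _ _
    have hsum : s₁.toReal + s₂.toReal = 1 := by
      have h1 : (η : Measure Y) univ = 1 := measure_univ
      rw [hη2] at h1
      simp only [Measure.coe_add, Measure.coe_smul, Pi.add_apply, Pi.smul_apply, measure_univ,
        smul_eq_mul, mul_one] at h1
      rw [← ENNReal.toReal_add hs₁ hs₂, h1, ENNReal.toReal_one]
    have hint : ∫ y, g y ∂(η : Measure Y) = s₁.toReal * g y₁ + s₂.toReal * g y₂ := by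
      rw [hη2, integral_add_measure ((integrable_of_continuous g.continuous _).smul_measure hs₁)
        ((integrable_of_continuous g.continuous _).smul_measure hs₂), integral_smul_measure,
        integral_smul_measure, integral_dirac, integral_dirac]
      rfl
    have hρ2 : ρ = s₂.toReal := by
      rw [hρ, hint, div_eq_iff (sub_pos.2 (hg h)).ne']
      linear_combination (g y₁) * hsum
    have hρ1 : 1 - ρ = s₁.toReal := by linarith
    refine ⟨⟨by rw [hρ2]; positivity, ?_⟩, ?_⟩
    · have : 0 ≤ s₁.toReal := ENNReal.toReal_nonneg
      linarith
    · rw [hρ1, hρ2, ENNReal.ofReal_toReal hs₁, ENNReal.ofReal_toReal hs₂]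
      exact hη2

end MomentCase

/-! ### Countability of firms with three worker types. -/

section TwoPoint

open Topology Filter

variable {X : Type*} {c d : ℝ}

/-- If workers of type `y` between two types in `Γ x` are never in `Γ x'` for `r x x'`, then
`Γ x` contains three types for at most countably many `x`. -/
theorem countable_three_point {Γ : X → Set (Icc c d)} {r : X → X → Prop}
    (hr : ∀ x x', x ≠ x' → r x x' ∨ r x' x)
    (hΓ : ∀ x x', r x x' → ∀ y₁ ∈ Γ x, ∀ y₂ ∈ Γ x, ∀ y ∈ Γ x', y₁ < y → y < y₂ → False) :
    {x | ∃ y₁ ∈ Γ x, ∃ y₂ ∈ Γ x, ∃ y₃ ∈ Γ x, y₁ < y₂ ∧ y₂ < y₃}.Countable := by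
  have hq : ∀ x : {x | ∃ y₁ ∈ Γ x, ∃ y₂ ∈ Γ x, ∃ y₃ ∈ Γ x, y₁ < y₂ ∧ y₂ < y₃}, ∃ s : ℚ × ℚ,
      ∃ y₁ ∈ Γ x, ∃ y₂ ∈ Γ x, ∃ y₃ ∈ Γ x,
        (y₁ : ℝ) < s.1 ∧ s.1 < (y₂ : ℝ) ∧ (y₂ : ℝ) < s.2 ∧ s.2 < (y₃ : ℝ) := by
    rintro ⟨x, y₁, h₁, y₂, h₂, y₃, h₃, h12, h23⟩
    obtain ⟨s, hs⟩ := exists_rat_btwn (show (y₁ : ℝ) < y₂ from h12)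
    obtain ⟨t, ht⟩ := exists_rat_btwn (show (y₂ : ℝ) < y₃ from h23)
    exact ⟨(s, t), y₁, h₁, y₂, h₂, y₃, h₃, hs.1, hs.2, ht.1, ht.2⟩
  choose s hs using hq
  -- Each triple is separated by a rational pair. If two firms shared a pair, the middle type of
  -- `x'` would lie between the outer types of `x`.
  have key : ∀ x x', r x.1 x'.1 → s x = s x' → False := by
    intro x x' hxx' he
    obtain ⟨y₁, h₁, -, -, y₃, h₃, ha, hb, hc, hd⟩ := hs x
    obtain ⟨-, -, y₂', h₂', -, -, -, hb', hc', -⟩ := hs x'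
    rw [he] at ha hd
    exact hΓ _ _ hxx' y₁ h₁ y₃ h₃ y₂' h₂' (show (y₁ : ℝ) < y₂' from ha.trans hb')
      (show (y₂' : ℝ) < y₃ from hc'.trans hd)
  have hinj : Function.Injective s := by
    intro x x' he
    by_contra hne
    rcases hr x.1 x'.1 fun h => hne (Subtype.ext h) with h | h
    · exact key x x' h he
    · exact key x' x h he.symm
  exact countable_coe_iff.1 hinj.countable

end TwoPoint

/-! ### Contact sets and the two-point structure. -/

section Structure

open Topology Filter

variable {a b c d : ℝ} {u : Icc a b → ℝ → ℝ} {M : Icc a b → C(Icc c d, ℝ)}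

theorem nullSingletonClass_of_hasContPosDensity {μ : ProbabilityMeasure (Icc a b)}
    (hμ : HasContPosDensity μ) : NullSingletonClass (μ : Measure (Icc a b)) := by
  obtain ⟨f, -, -, hf⟩ := hμ
  rw [hf]
  refine ⟨fun x => withDensity_absolutelyContinuous _ _ ?_⟩
  rw [Measure.comap_apply _ Subtype.val_injective
    (fun s hs => (measurableSet_Icc.subtype_image hs)) _ (measurableSet_singleton x)]
  simp

/-- The equilibrium assignment exists, is unique, and hires at most two worker types, when the
firms are ordered by a total relation `r` such that the difference of the (rescaled) input
functions is strictly quasiconvex. -/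
theorem exists_unique_two_point (hab : a < b) (hcd : c < d)
    {μ : ProbabilityMeasure (Icc a b)} {ν : ProbabilityMeasure (Icc c d)}
    (hμ : HasContPosDensity μ)
    (hV : Continuous fun w : Icc a b × ProbabilityMeasure (Icc c d) => momentOutput u M w.1 w.2)
    {L : NNReal} (hL : ∀ η, LipschitzWith L fun x => momentOutput u M x η)
    (hc : ∀ x, StrictConcaveOn ℝ univ (u x)) (hd : ∀ x, Differentiable ℝ (u x))
    (hpos : ∀ x z, 0 < deriv (u x) z) {K : NNReal}
    (hK : ∀ (x : Icc a b) (η : ProbabilityMeasure (Icc c d)),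
      LipschitzWith K fun y => deriv (u x) (∫ y, M x y ∂(η : Measure (Icc c d))) * M x y)
    (hM : ∀ x, StrictMono (M x)) {r : Icc a b → Icc a b → Prop}
    (hr : ∀ x x', x ≠ x' → r x x' ∨ r x' x)
    (hcross : ∀ x x', r x x' → ∀ φ φ' : ℝ, 0 < φ' → ∀ y₁ y y₂, y₁ < y → y < y₂ →
      φ' * M x' y₁ - φ * M x y₁ ≤ φ' * M x' y - φ * M x y →
      φ' * M x' y₂ - φ * M x y₂ ≤ φ' * M x' y - φ * M x y → False) :
    ∃ γ : ProbabilityMeasure (Icc a b × ProbabilityMeasure (Icc c d)),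
      IsEquilibriumAssignment (momentOutput u M) μ ν γ ∧
      (∀ γ', IsEquilibriumAssignment (momentOutput u M) μ ν γ' → γ' = γ) ∧
      ∃ (Xs : Set (Icc a b)) (ρ : Icc a b → ℝ) (Td Tu : Icc a b → Icc c d),
        MeasurableSet Xs ∧ (μ : Measure (Icc a b)) Xs = 1 ∧ IsTwoPointOn γ Xs ρ Td Tu ∧
        ∀ x ∈ Xs, ∀ x' ∈ Xs, r x x' → Td x' ∉ Ioo (Td x) (Tu x) ∧ Tu x' ∉ Ioo (Td x) (Tu x) := by
  have : Nonempty (Icc a b) := ⟨⟨a, le_rfl, hab.le⟩⟩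
  have : Nonempty (Icc c d) := ⟨⟨c, le_rfl, hcd.le⟩⟩
  obtain ⟨q, hqK, hq⟩ := exists_minimizer_dualValue (μ := μ) (ν := ν) hV hL
    (exists_lipschitz_improvement hV hc hd hK)
  obtain ⟨z, w, hzw, hle⟩ := exists_shadow_values hV hc hd q
  let Γ : Icc a b → Set (Icc c d) := fun x => {y | deriv (u x) (z x) * M x y - q y = w x}
  have hΓη : ∀ x, ∀ η ∈ optimalWorkforces (momentOutput u M) q x,
      ∀ᵐ y ∂(η : Measure (Icc c d)), y ∈ Γ x := fun x η hη =>
    ae_eq_of_optimal (hzw x η hη).1 (hzw x η hη).2 (hle x)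
  have hΓne : ∀ x, (Γ x).Nonempty := fun x => by
    obtain ⟨η, hη⟩ := nonempty_optimalWorkforces hV q x
    exact (hΓη x η hη).exists
  have hΓcpt : ∀ x, IsCompact (Γ x) := fun x =>
    (isClosed_eq (((M x).continuous.const_mul _).sub q.continuous) continuous_const).isCompact
  have hΓcross : ∀ x x', r x x' → ∀ y₁ ∈ Γ x, ∀ y₂ ∈ Γ x, ∀ y ∈ Γ x', y₁ < y → y < y₂ →
      False := by
    intro x x' hxx' y₁ (h₁ : _ = _) y₂ (h₂ : _ = _) y (h : _ = _) h1 h2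
    -- Adding the contact equalities of each firm to its inequality at the other's type cancels the
    -- wages.
    refine hcross x x' hxx' (deriv (u x) (z x)) _ (hpos x' (z x')) y₁ y y₂ h1 h2 ?_ ?_
    · linarith [hle x y, hle x' y₁]
    · linarith [hle x y, hle x' y₂]
  choose Td hTd using fun x => (hΓcpt x).exists_isLeast (hΓne x)
  choose Tu hTu using fun x => (hΓcpt x).exists_isGreatest (hΓne x)
  let N := {x | ∃ y₁ ∈ Γ x, ∃ y₂ ∈ Γ x, ∃ y₃ ∈ Γ x, y₁ < y₂ ∧ y₂ < y₃}
  have hN : N.Countable := countable_three_point hr hΓcross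
  have hXs : MeasurableSet Nᶜ := hN.measurableSet.compl
  have := nullSingletonClass_of_hasContPosDensity hμ
  have hμN : (μ : Measure (Icc a b)) N = 0 := hN.measure_zero _
  have hΓ2 : ∀ x ∈ Nᶜ, ∀ y ∈ Γ x, y = Td x ∨ y = Tu x := by
    intro x hx y hy
    by_contra! h
    exact hx ⟨Td x, (hTd x).1, y, hy, Tu x, (hTu x).1, lt_of_le_of_ne ((hTd x).2 hy) h.1.symm,
      lt_of_le_of_ne ((hTu x).2 hy) h.2⟩
  -- The weight depends on `x` only through the common moment `z x`, so all optimal workforces of a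
  -- firm outside `N` coincide.
  let ρ : Icc a b → ℝ := fun x => (z x - M x (Td x)) / (M x (Tu x) - M x (Td x))
  have hTle : ∀ x, Td x ≤ Tu x := fun x => (hTd x).2 (hTu x).1
  have hmix : ∀ x ∈ Nᶜ, ∀ η ∈ optimalWorkforces (momentOutput u M) q x, ρ x ∈ Icc (0 : ℝ) 1 ∧
      (η : Measure (Icc c d)) = ENNReal.ofReal (1 - ρ x) • Measure.dirac (Td x)
        + ENNReal.ofReal (ρ x) • Measure.dirac (Tu x) := by
    intro x hx η hη
    refine eq_two_point (g := M x) (fun h => hM x (lt_of_le_of_ne (hTle x) h))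
      ((hΓη x η hη).mono (hΓ2 x hx)) ?_
    rw [(hzw x η hη).1]
  obtain ⟨γ, h1, h2, h3⟩ := exists_unique_equilibriumAssignment (μ := μ) (ν := ν) hV hL hqK hq hXs
    (compl_mem_ae_iff.2 hμN) fun x hx η hη η' hη' => ProbabilityMeasure.toMeasure_injective
      ((hmix x hx η hη).2.trans (hmix x hx η' hη').2.symm)
  refine ⟨γ, h1, h2, Nᶜ, ρ, Td, Tu, hXs, (prob_compl_eq_one_iff hN.measurableSet).2 hμN,
    ⟨fun x hx => ?_, fun x _ => hTle x, fun w hw hx => (hmix w.1 hx w.2 (h3 w hw)).2⟩,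
    fun x _ x' _ hxx' => ⟨fun h => ?_, fun h => ?_⟩⟩
  · obtain ⟨η, hη⟩ := nonempty_optimalWorkforces hV q x
    exact (hmix x hx η hη).1
  · exact hΓcross x x' hxx' _ (hTd x).1 _ (hTu x).1 _ (hTd x').1 h.1 h.2
  · exact hΓcross x x' hxx' _ (hTd x).1 _ (hTu x).1 _ (hTu x').1 h.1 h.2

end Structure

/-! ### Smoothness, single crossing and Lipschitz bounds for `v` and `m`. -/

section Calculus

open Topology Filter

theorem exists_lipschitzOnWith_of_contDiffOn {E : Type*} [NormedAddCommGroup E] [NormedSpace ℝ E]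
    {f : E → ℝ} {s : Set E} (hs : IsCompact s) (hconv : Convex ℝ s) (hu : UniqueDiffOn ℝ s)
    (hf : ContDiffOn ℝ 1 f s) : ∃ C, LipschitzOnWith C f s := by
  have hc : ContinuousOn (fun x => ‖fderivWithin ℝ f s x‖₊) s :=
    (hf.continuousOn_fderivWithin hu le_rfl).nnnorm
  obtain ⟨C, hC⟩ := (hs.image_of_continuousOn hc).bddAbove
  exact ⟨C, hconv.lipschitzOnWith_of_nnnorm_fderivWithin_le (hf.differentiableOn one_ne_zero)
    fun x hx => hC ⟨x, hx, rfl⟩⟩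

/-- The derivative of `p₂ / p₁` has the sign of the difference of logarithmic derivatives. With `pᵢ
= m_y(·, ξᵢ)` this turns strict log-supermodularity into monotone ratios. -/
theorem mul_lt_mul_of_logDeriv_lt {a b : ℝ} {p₁ p₂ : ℝ → ℝ}
    (h₁ : DifferentiableOn ℝ p₁ (Icc a b)) (h₂ : DifferentiableOn ℝ p₂ (Icc a b))
    (hp₁ : ∀ s ∈ Icc a b, 0 < p₁ s) (hp₂ : ∀ s ∈ Icc a b, 0 < p₂ s)
    (h : ∀ s ∈ Icc a b, derivWithin p₁ (Icc a b) s / p₁ s < derivWithin p₂ (Icc a b) s / p₂ s)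
    {s s' : ℝ} (hs : s ∈ Icc a b) (hs' : s' ∈ Icc a b) (hss' : s < s') :
    p₁ s' * p₂ s < p₂ s' * p₁ s := by
  have hmono : StrictMonoOn (fun s => p₂ s / p₁ s) (Icc a b) := by
    refine strictMonoOn_of_deriv_pos (convex_Icc a b)
      (h₂.continuousOn.div h₁.continuousOn fun s hs => (hp₁ s hs).ne') fun s hs => ?_
    rw [interior_Icc] at hs
    have hmem := Icc_mem_nhds hs.1 hs.2
    have hsI : s ∈ Icc a b := Ioo_subset_Icc_self hs
    have hlt := h s hsI
    rw [derivWithin_of_mem_nhds hmem, derivWithin_of_mem_nhds hmem,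
      div_lt_div_iff₀ (hp₁ s hsI) (hp₂ s hsI)] at hlt
    have hd : deriv (fun s => p₂ s / p₁ s) s
        = (deriv p₂ s * p₁ s - p₂ s * deriv p₁ s) / p₁ s ^ 2 :=
      deriv_fun_div ((h₂ s hsI).differentiableAt hmem) ((h₁ s hsI).differentiableAt hmem)
        (hp₁ s hsI).ne'
    rw [hd]
    have := hp₁ s hsI
    exact div_pos (by linarith) (by positivity)
  have := hmono hs hs' hss'
  simp only at this
  rw [div_lt_div_iff₀ (hp₁ s hs) (hp₁ s' hs')] at this
  linarith

variable {a b c d : ℝ} {v m : ℝ → ℝ → ℝ}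

/-- On the rectangle `m_y` is the Fréchet derivative of `m` applied to `(0, 1)`, and that derivative
is continuously differentiable. -/
theorem IsMomentSpecification.differentiableOn_partialY (hab : a < b) (hcd : c < d)
    (hvm : IsMomentSpecification a b c d v m) {y : ℝ} (hy : y ∈ Icc c d) :
    DifferentiableOn ℝ (fun s => partialY c d m s y) (Icc a b) := by
  let S : Set (ℝ × ℝ) := Icc a b ×ˢ Icc c d
  let F : ℝ × ℝ → ℝ := fun w => m w.1 w.2
  have hu : UniqueDiffOn ℝ S := (uniqueDiffOn_Icc hab).prod (uniqueDiffOn_Icc hcd)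
  have hF : ContDiffOn ℝ 2 F S := hvm.contDiff_m
  have heq : ∀ s ∈ Icc a b, partialY c d m s y = fderivWithin ℝ F S (s, y) (0, 1) := by
    intro s hs
    have h1 : HasFDerivWithinAt F (fderivWithin ℝ F S (s, y)) S (s, y) :=
      (hF.differentiableOn two_ne_zero (s, y) ⟨hs, hy⟩).hasFDerivWithinAt
    have h2 : HasDerivWithinAt (fun t : ℝ => (s, t)) (0, 1) (Icc c d) y :=
      (hasDerivWithinAt_const _ _ _).prodMk (hasDerivWithinAt_id _ _)
    have h3 := h1.comp_hasDerivWithinAt y h2 fun t ht => ⟨hs, ht⟩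
    exact h3.derivWithin (uniqueDiffOn_Icc hcd y hy)
  have hdiff : DifferentiableOn ℝ (fun s => fderivWithin ℝ F S (s, y) (0, 1)) (Icc a b) := by
    have h1 : DifferentiableOn ℝ (fderivWithin ℝ F S) S :=
      (hF.fderivWithin hu (m := 1) (by norm_num)).differentiableOn one_ne_zero
    have h2 : DifferentiableOn ℝ (fun s => fderivWithin ℝ F S (s, y)) (Icc a b) :=
      h1.comp (f := fun s : ℝ => (s, y)) (by fun_prop) fun s hs => ⟨hs, hy⟩
    exact h2.clm_apply (differentiableOn_const _)
  exact hdiff.congr heq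

theorem IsMomentSpecification.hasDerivAt_m (hvm : IsMomentSpecification a b c d v m) {x y : ℝ}
    (hx : x ∈ Icc a b) (hy : y ∈ Ioo c d) : HasDerivAt (m x) (partialY c d m x y) y := by
  have hyI := Ioo_subset_Icc_self hy
  -- `derivWithin` is zero where no derivative exists, so positivity already gives
  -- differentiability.
  have h := differentiableWithinAt_of_derivWithin_ne_zero (hvm.m_y_pos x hx y hyI).ne'
  exact h.hasDerivWithinAt.hasDerivAt (Icc_mem_nhds hy.1 hy.2)

theorem IsMomentSpecification.continuousOn_m (hvm : IsMomentSpecification a b c d v m) {x : ℝ}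
    (hx : x ∈ Icc a b) : ContinuousOn (m x) (Icc c d) :=
  hvm.contDiff_m.continuousOn.comp (f := fun y : ℝ => (x, y)) (by fun_prop) fun _ hy => ⟨hx, hy⟩

theorem IsMomentSpecification.strictMonoOn_m (hvm : IsMomentSpecification a b c d v m) {x : ℝ}
    (hx : x ∈ Icc a b) : StrictMonoOn (m x) (Icc c d) := by
  refine strictMonoOn_of_deriv_pos (convex_Icc c d) (hvm.continuousOn_m hx) fun y hy => ?_
  rw [interior_Icc] at hy
  rw [(hvm.hasDerivAt_m hx hy).deriv]
  exact hvm.m_y_pos x hx y (Ioo_subset_Icc_self hy)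

/-- A peak of `D` at `y` relative to `y₁` and `y₂` gives mean-value points `ξ₁ < ξ₂` with `D' ξ₁ ≥ 0
≥ D' ξ₂`, so `φ' m_y(x', ·) / m_y(x, ·)` is at least `φ` at `ξ₁` and at most `φ` at `ξ₂`. This
contradicts its strict increase. -/
theorem IsMomentSpecification.crossing (hvm : IsMomentSpecification a b c d v m) {x x' : ℝ}
    (hx : x ∈ Icc a b) (hx' : x' ∈ Icc a b)
    (hratio : ∀ ξ₁ ∈ Icc c d, ∀ ξ₂ ∈ Icc c d, ξ₁ < ξ₂ →
      partialY c d m x' ξ₁ * partialY c d m x ξ₂ < partialY c d m x' ξ₂ * partialY c d m x ξ₁)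
    {φ φ' : ℝ} (hφ' : 0 < φ') {y₁ y y₂ : ℝ} (hy₁ : y₁ ∈ Icc c d) (hy₂ : y₂ ∈ Icc c d)
    (h1 : y₁ < y) (h2 : y < y₂)
    (hD₁ : φ' * m x' y₁ - φ * m x y₁ ≤ φ' * m x' y - φ * m x y)
    (hD₂ : φ' * m x' y₂ - φ * m x y₂ ≤ φ' * m x' y - φ * m x y) : False := by
  let D : ℝ → ℝ := fun t => φ' * m x' t - φ * m x t
  have hDc : ContinuousOn D (Icc c d) :=
    ((hvm.continuousOn_m hx').const_mul _).sub ((hvm.continuousOn_m hx).const_mul _)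
  have hDd : ∀ t ∈ Ioo c d,
      HasDerivAt D (φ' * partialY c d m x' t - φ * partialY c d m x t) t := fun t ht =>
    ((hvm.hasDerivAt_m hx' ht).const_mul _).sub ((hvm.hasDerivAt_m hx ht).const_mul _)
  obtain ⟨ξ₁, hξ₁, e₁⟩ := exists_hasDerivAt_eq_slope D _ h1
    (hDc.mono (Icc_subset_Icc hy₁.1 (h2.le.trans hy₂.2)))
    fun t ht => hDd t ⟨hy₁.1.trans_lt ht.1, ht.2.trans (h2.trans_le hy₂.2)⟩
  obtain ⟨ξ₂, hξ₂, e₂⟩ := exists_hasDerivAt_eq_slope D _ h2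
    (hDc.mono (Icc_subset_Icc (hy₁.1.trans h1.le) hy₂.2))
    fun t ht => hDd t ⟨(hy₁.1.trans_lt h1).trans ht.1, ht.2.trans_le hy₂.2⟩
  have s₁ : 0 ≤ φ' * partialY c d m x' ξ₁ - φ * partialY c d m x ξ₁ := by
    rw [e₁]
    exact div_nonneg (sub_nonneg.2 hD₁) (sub_nonneg.2 h1.le)
  have s₂ : φ' * partialY c d m x' ξ₂ - φ * partialY c d m x ξ₂ ≤ 0 := by
    rw [e₂]
    exact div_nonpos_of_nonpos_of_nonneg (sub_nonpos.2 hD₂) (sub_nonneg.2 h2.le)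
  have m₁ : ξ₁ ∈ Icc c d := ⟨hy₁.1.trans hξ₁.1.le, hξ₁.2.le.trans (h2.le.trans hy₂.2)⟩
  have m₂ : ξ₂ ∈ Icc c d := ⟨(hy₁.1.trans h1.le).trans hξ₂.1.le, hξ₂.2.le.trans hy₂.2⟩
  have hlt := mul_lt_mul_of_pos_left
    (hratio ξ₁ m₁ ξ₂ m₂ (hξ₁.2.trans hξ₂.1)) hφ'
  have t₁ := mul_nonneg s₁ (hvm.m_y_pos x hx ξ₂ m₂).le
  have t₂ := mul_nonneg (neg_nonneg.2 s₂) (hvm.m_y_pos x hx ξ₁ m₁).le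
  linarith

theorem IsMomentSpecification.ratio_of_supermodular (hab : a < b) (hcd : c < d)
    (hvm : IsMomentSpecification a b c d v m) (hsup : StrictlyLogSupermodular a b c d m)
    {x x' : ℝ} (hx : x ∈ Icc a b) (hx' : x' ∈ Icc a b) (hxx' : x < x') :
    ∀ ξ₁ ∈ Icc c d, ∀ ξ₂ ∈ Icc c d, ξ₁ < ξ₂ →
      partialY c d m x' ξ₁ * partialY c d m x ξ₂ < partialY c d m x' ξ₂ * partialY c d m x ξ₁ :=
  fun ξ₁ h₁ ξ₂ h₂ h => mul_lt_mul_of_logDeriv_lt (hvm.differentiableOn_partialY hab hcd h₁)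
    (hvm.differentiableOn_partialY hab hcd h₂) (fun s hs => hvm.m_y_pos s hs ξ₁ h₁)
    (fun s hs => hvm.m_y_pos s hs ξ₂ h₂) (fun s hs => hsup s hs h₁ h₂ h) hx hx' hxx'

theorem IsMomentSpecification.ratio_of_submodular (hab : a < b) (hcd : c < d)
    (hvm : IsMomentSpecification a b c d v m) (hsub : StrictlyLogSubmodular a b c d m)
    {x x' : ℝ} (hx : x ∈ Icc a b) (hx' : x' ∈ Icc a b) (hxx' : x' < x) :
    ∀ ξ₁ ∈ Icc c d, ∀ ξ₂ ∈ Icc c d, ξ₁ < ξ₂ →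
      partialY c d m x' ξ₁ * partialY c d m x ξ₂ < partialY c d m x' ξ₂ * partialY c d m x ξ₁ := by
  intro ξ₁ h₁ ξ₂ h₂ h
  -- Both the two worker types and the order of the firms are reversed, so the two reversals cancel.
  have := mul_lt_mul_of_logDeriv_lt (hvm.differentiableOn_partialY hab hcd h₂)
    (hvm.differentiableOn_partialY hab hcd h₁) (fun s hs => hvm.m_y_pos s hs ξ₂ h₂)
    (fun s hs => hvm.m_y_pos s hs ξ₁ h₁) (fun s hs => hsub s hs h₁ h₂ h) hx' hx hxx'
  linarith

/-- The labor input function of each firm, as a continuous function of the worker type. -/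
def laborInput (hvm : IsMomentSpecification a b c d v m) : C(Icc a b, C(Icc c d, ℝ)) :=
  ContinuousMap.curry ⟨fun w => m w.1 w.2, hvm.contDiff_m.continuousOn.comp_continuous
    (f := fun w : Icc a b × Icc c d => ((w.1 : ℝ), (w.2 : ℝ))) (by fun_prop)
    fun w => ⟨w.1.2, w.2.2⟩⟩

theorem continuous_momentOutput (hvm : IsMomentSpecification a b c d v m) :
    Continuous fun w : Icc a b × ProbabilityMeasure (Icc c d) =>
      momentOutput (fun x : Icc a b => v x) (laborInput hvm) w.1 w.2 := by
  refine hvm.contDiff_v.continuousOn.comp_continuous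
    (f := fun w : Icc a b × ProbabilityMeasure (Icc c d) =>
      ((w.1 : ℝ), ∫ y, laborInput hvm w.1 y ∂(w.2 : Measure (Icc c d)))) ?_
    fun w => ⟨w.1.2, mem_univ _⟩
  exact (continuous_subtype_val.comp continuous_fst).prodMk
    (continuous_integral_prod.comp (((laborInput hvm).continuous.comp continuous_fst).prodMk
      continuous_snd))

/-- Uniform Lipschitz bounds for the output and for the shadow value of labor. -/
theorem exists_lipschitz_bounds (hab : a < b) (hcd : c < d)
    (hvm : IsMomentSpecification a b c d v m) :
    ∃ L K : NNReal,
      (∀ η, LipschitzWith L fun x => momentOutput (fun x : Icc a b => v x) (laborInput hvm) x η) ∧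
      ∀ (x : Icc a b) (η : ProbabilityMeasure (Icc c d)), LipschitzWith K fun y =>
        deriv (v x) (∫ y, laborInput hvm x y ∂(η : Measure (Icc c d))) * laborInput hvm x y := by
  obtain ⟨Cm, hCm⟩ := exists_lipschitzOnWith_of_contDiffOn (isCompact_Icc.prod isCompact_Icc)
    ((convex_Icc a b).prod (convex_Icc c d))
    ((uniqueDiffOn_Icc hab).prod (uniqueDiffOn_Icc hcd)) (hvm.contDiff_m.of_le one_le_two)
  let z : Icc a b → ProbabilityMeasure (Icc c d) → ℝ := fun x η =>
    ∫ y, laborInput hvm x y ∂(η : Measure (Icc c d))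
  obtain ⟨R, hR⟩ : ∃ R, ∀ x η, |z x η| ≤ R := by
    obtain ⟨R, hR⟩ := isCompact_univ.exists_bound_of_continuousOn
      (f := fun w : Icc a b × ProbabilityMeasure (Icc c d) => z w.1 w.2)
      (continuous_integral_prod.comp (((laborInput hvm).continuous.comp continuous_fst).prodMk
        continuous_snd)).continuousOn
    exact ⟨R, fun x η => hR (x, η) (mem_univ _)⟩
  -- The margin `1` keeps every moment in the interior, where a Lipschitz constant of `v x` bounds
  -- its derivative.
  have hzI : ∀ x η, z x η ∈ Ioo (-(|R| + 1)) (|R| + 1) := fun x η => by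
    have h1 := abs_le.1 (hR x η)
    have h2 := le_abs_self R
    constructor <;> linarith
  have hR1 : -(|R| + 1) < |R| + 1 := by have := abs_nonneg R; linarith
  obtain ⟨Cv, hCv⟩ := exists_lipschitzOnWith_of_contDiffOn
    (isCompact_Icc.prod (isCompact_Icc (a := -(|R| + 1)) (b := |R| + 1)))
    ((convex_Icc a b).prod (convex_Icc _ _))
    ((uniqueDiffOn_Icc hab).prod (uniqueDiffOn_Icc hR1))
    ((hvm.contDiff_v.of_le one_le_two).mono (prod_mono_right (subset_univ _)))
  have hzL : ∀ η, LipschitzWith Cm fun x => z x η := by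
    intro η
    refine LipschitzWith.of_dist_le_mul fun x x' => ?_
    rw [Real.dist_eq]
    refine (abs_integral_sub_le _ _ η).trans ?_
    refine (ContinuousMap.norm_le _ (by positivity)).2 fun y => ?_
    have := hCm.dist_le_mul ((x : ℝ), (y : ℝ)) ⟨x.2, y.2⟩ ((x' : ℝ), (y : ℝ)) ⟨x'.2, y.2⟩
    simp only [Prod.dist_eq, Real.dist_eq, sub_self, abs_zero, abs_nonneg,
      sup_of_le_left] at this
    exact this
  have hMl : ∀ x, LipschitzWith Cm (laborInput hvm x) := by
    intro x
    refine LipschitzWith.of_dist_le_mul fun y y' => ?_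
    have := hCm.dist_le_mul ((x : ℝ), (y : ℝ)) ⟨x.2, y.2⟩ ((x : ℝ), (y' : ℝ)) ⟨x.2, y'.2⟩
    simp only [Prod.dist_eq, Real.dist_eq, sub_self, abs_zero, abs_nonneg,
      sup_of_le_right] at this
    exact this
  -- `max 1 Cm` is the constant of `x ↦ (x, z x η)` in the sup metric; `Cv` bounds the shadow value
  -- and `Cm` the slope of labor input.
  refine ⟨Cv * max 1 Cm, Cv * Cm, fun η => ?_, fun x η => ?_⟩
  · have h1 : LipschitzWith (max 1 Cm) fun x : Icc a b => ((x : ℝ), z x η) :=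
      (LipschitzWith.subtype_val _).prodMk (hzL η)
    have h2 := hCv.comp (h1.lipschitzOnWith (s := univ))
      fun x _ => ⟨x.2, Ioo_subset_Icc_self (hzI x η)⟩
    exact lipschitzOnWith_univ.1 h2
  · have hvl : LipschitzOnWith Cv (v x) (Icc (-(|R| + 1)) (|R| + 1)) := by
      refine LipschitzOnWith.of_dist_le_mul fun t ht t' ht' => ?_
      have := hCv.dist_le_mul ((x : ℝ), t) ⟨x.2, ht⟩ ((x : ℝ), t') ⟨x.2, ht'⟩
      simpa [Prod.dist_eq] using this
    have hB : ‖deriv (v x) (z x η)‖ ≤ Cv :=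
      norm_deriv_le_of_lipschitzOn (Icc_mem_nhds (hzI x η).1 (hzI x η).2) hvl
    refine LipschitzWith.of_dist_le_mul fun y y' => ?_
    rw [Real.dist_eq, ← mul_sub, abs_mul, NNReal.coe_mul, mul_assoc]
    exact mul_le_mul hB ((hMl x).dist_le_mul y y') (abs_nonneg _) Cv.2

/-- Existence, uniqueness and two-point structure of the equilibrium assignment for an order `r`
on firms along which `m_y` has strictly increasing ratios. -/
theorem IsMomentSpecification.exists_unique_two_point (hab : a < b) (hcd : c < d)
    {μ : ProbabilityMeasure (Icc a b)} {ν : ProbabilityMeasure (Icc c d)}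
    (hμ : HasContPosDensity μ) (hvm : IsMomentSpecification a b c d v m)
    {r : Icc a b → Icc a b → Prop} (hr : ∀ x x', x ≠ x' → r x x' ∨ r x' x)
    (hratio : ∀ x x', r x x' → ∀ ξ₁ ∈ Icc c d, ∀ ξ₂ ∈ Icc c d, ξ₁ < ξ₂ →
      partialY c d m x' ξ₁ * partialY c d m x ξ₂ < partialY c d m x' ξ₂ * partialY c d m x ξ₁) :
    ∃ γ : ProbabilityMeasure (Icc a b × ProbabilityMeasure (Icc c d)),
      IsEquilibriumAssignment (momentValue v m) μ ν γ ∧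
      (∀ γ', IsEquilibriumAssignment (momentValue v m) μ ν γ' → γ' = γ) ∧
      ∃ (Xs : Set (Icc a b)) (ρ : Icc a b → ℝ) (Td Tu : Icc a b → Icc c d),
        MeasurableSet Xs ∧ (μ : Measure (Icc a b)) Xs = 1 ∧ IsTwoPointOn γ Xs ρ Td Tu ∧
        ∀ x ∈ Xs, ∀ x' ∈ Xs, r x x' → Td x' ∉ Ioo (Td x) (Tu x) ∧ Tu x' ∉ Ioo (Td x) (Tu x) := by
  obtain ⟨L, K, hL, hK⟩ := exists_lipschitz_bounds hab hcd hvm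
  have hd : ∀ x : Icc a b, Differentiable ℝ (v x) := fun x z =>
    differentiableAt_of_deriv_ne_zero (hvm.v_z_pos x x.2 z).ne'
  exact ManyToOne.exists_unique_two_point (u := fun x => v x) (M := laborInput hvm) hab hcd hμ
    (continuous_momentOutput hvm) hL
    (fun x => strictConcaveOn_univ_of_deriv2_neg (hd x).continuous (hvm.v_zz_neg x x.2)) hd
    (fun x => hvm.v_z_pos x x.2) hK (fun x y y' h => hvm.strictMonoOn_m x.2 y.2 y'.2 h) hr
    fun x x' hxx' φ φ' hφ' y₁ y y₂ h1 h2 => hvm.crossing x.2 x'.2 (hratio x x' hxx') hφ'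
      y₁.2 y₂.2 h1 h2

end Calculus

end ManyToOne

theorem mainTheorem8 (a b c d : ℝ) (hab : a < b) (hcd : c < d)
    (μ : ProbabilityMeasure (Icc a b)) (ν : ProbabilityMeasure (Icc c d))
    (hμ : ManyToOne.HasContPosDensity μ) (hν : ManyToOne.HasContPosDensity ν)
    (v m : ℝ → ℝ → ℝ) (hvm : ManyToOne.IsMomentSpecification a b c d v m) :
    (ManyToOne.StrictlyLogSupermodular a b c d m →
      ∃ γ : ProbabilityMeasure (Icc a b × ProbabilityMeasure (Icc c d)),
        ManyToOne.IsEquilibriumAssignment (ManyToOne.momentValue v m) μ ν γ ∧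
        (∀ γ', ManyToOne.IsEquilibriumAssignment (ManyToOne.momentValue v m) μ ν γ' → γ' = γ) ∧
        ManyToOne.IsStrictlySingleDipped μ γ) ∧
    (ManyToOne.StrictlyLogSubmodular a b c d m →
      ∃ γ : ProbabilityMeasure (Icc a b × ProbabilityMeasure (Icc c d)),
        ManyToOne.IsEquilibriumAssignment (ManyToOne.momentValue v m) μ ν γ ∧
        (∀ γ', ManyToOne.IsEquilibriumAssignment (ManyToOne.momentValue v m) μ ν γ' → γ' = γ) ∧
        ManyToOne.IsStrictlySinglePeaked μ γ) := by
  refine ⟨fun hsup => ?_, fun hsub => ?_⟩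
  · exact hvm.exists_unique_two_point hab hcd hμ (r := fun x x' => x < x')
      (fun x x' h => lt_or_gt_of_ne h)
      fun x x' h => hvm.ratio_of_supermodular hab hcd hsup x.2 x'.2 h
  -- In both cases `r x x'` orders firms so that `m_y(x', ·) / m_y(x, ·)` increases; submodularity
  -- reverses that order.
  · exact hvm.exists_unique_two_point hab hcd hμ (r := fun x x' => x' < x)
      (fun x x' h => (lt_or_gt_of_ne h).symm)
      fun x x' h => hvm.ratio_of_submodular hab hcd hsub x.2 x'.2 h
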